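/- **Setting.** Let $n\ge 1$, let $A\in\mathbb R^{n\times n}$ be symmetric with zero diagonal, and let $\theta\in\mathbb R^n$. The Ising model $\mathcal D(A,\theta)$ is the law on $\{-1,1\}^n$ with $\Pr[Z=z]\propto\exp\big(\sum_{i<j}A_{ij}z_iz_j+\sum_i\theta_iz_i\big)$. For $p\in[0,1]$, a corrupted sample with missing probability $p$ is obtained by drawing $Z\sim\mathcal D(A,\theta)$ and replacing every coordinate independently with probability $p$ by the symbol $?$. Let $\mathcal D_p^{T}$ be the joint law of $T$ independent corrupted samples. Given $m$ corrupted samples, let $\hat p$ be the fraction of $?$ among their $mn$ entries. Let $d_{\mathrm{TV}}(\mu,\nu)=\sup_S|\mu(S)-\nu(S)|$. **Algorithm** (stochastic multiplicative gradient descent, with parameters $\lambda>0$ and $q$, for a vertex $v$). Read $?$ as $0$ and write $X\in\{-1,0,1\}^n$ for a sample. Vectors $w\in\mathbb R^{2n-1}$ have coordinates $w_i^+,w_i^-$ ($i\ne v$) and a slack coordinate; put $\Pi(w)_i=w_i^+-w_i^-$. Let $$g^i(w;X)=-\frac{X_v}{1-q}\cdot\frac{e^{-\Pi(w)_iX_vX_i}X_i}{1-q}\prod_{j\ne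 i,v}\frac{e^{-\Pi(w)_jX_vX_j}-q}{1-q},$$ and let $G(w;X)$ have entries $g^i$ at $w_i^+$, $-g^i$ at $w_i^-$, and $0$ at the slack coordinate. With $B=(1-q)^{-2}e^{\lambda/(1-q)}$ and $\eta=\min\{\frac1{8B},\frac1{2B}\sqrt{\log(2n-1)/T}\}$, start from $w^1\equiv\lambda/(2n-1)$, and for $t=1,\dots,T$ set $w^{t+1}_k=w^t_k\big(1-\eta G(w^t;X^t)_k+\eta C^t\big)$ for every coordinate $k$, where $C^t=\frac1\lambda\langle w^t,G(w^t;X^t)\rangle$. Output $\bar w^{(v)}=\frac1T\sum_{t=1}^Tw^t$. **Statement.** There is a universal constant $C_0>0$, and for every $p\in(0,1)$ there are constants $C,K>0$ depending only on $p$, such that the following holds for all $n,T\ge1$, all $A$ as above and all $\delta\in(0,1)$. 1. For all $\theta$ and all $m\ge C_0\frac{T}{\delta^2}\log\frac2\delta$, the estimate $\hat p$ computed from $m$ corrupted samples with missing probability $p$ satisfies $|\hat p-p|\le\delta/\sqrt{Tn}$ with probability at least $1-\delta$. 2. For all $\theta$ and all $q\in[0,1]$, $d_{\mathrm{TV}}(\mathcal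 D_p^T,\mathcal D_q^T)=d_{\mathrm{TV}}(\mathrm{Bin}(nT,p),\mathrm{Bin}(nT,q))$. 3. For all $\theta$ and all $q\in[0,1]$ with $|q-p|\le\delta/\sqrt{Tn}$, $d_{\mathrm{TV}}(\mathcal D_p^T,\mathcal D_q^T)\le K\delta$. 4. Let $\theta=0$, let $\lambda>0$ with $\sum_j|A_{ij}|\le\lambda$ for all $i$, let $\varepsilon>0$, and write $\lambda_+=\max\{1,\lambda\}$. Assume $$T\ge\lambda^2\lambda_+^2\log(n/\delta)\,e^{C\lambda_+}\varepsilon^{-4}$$ (which is $T\ge\lambda^4\log(n/\delta)e^{C\lambda}\varepsilon^{-4}$ when $\lambda\ge1$) and $m\ge C_0\frac{T}{\delta^2}\log\frac2\delta$. Draw $m+T$ independent corrupted samples with missing probability $p$, compute $\hat p$ from the first $m$, and run the algorithm with $q=\hat p$ on the remaining $T$, for every vertex $v$. Then, with probability at least $1-K\delta$, $|\Pi(\bar w^{(v)})_i-A_{vi}|\le\varepsilon$ for all vertices $v$ and all $i\ne v$. -/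

import Mathlib

open MeasureTheory ProbabilityTheory
open scoped unitInterval

noncomputable section

namespace IsingMissing

/-- A spin configuration in `{-1, 1}^n`. -/
abbrev Config (n : ℕ) := Fin n → ℤˣ

/-- The alphabet `{-1, 1, ?}` of an observed entry: `none` stands for the missing symbol `?`. -/
abbrev Entry := Option ℤˣ

instance : MeasurableSpace Entry := ⊤

instance : DiscreteMeasurableSpace Entry := ⟨fun _ => trivial⟩

instance : DiscreteMeasurableSpace ℤˣ :=
  ⟨fun s => ⟨Units.val '' s, trivial, Set.preimage_image_eq s Units.val_injective⟩⟩

/-- An observed (corrupted) sample in `{-1, 1, ?}^n`. -/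
abbrev Obs (n : ℕ) := Fin n → Entry

/-- The real number carried by an observed entry, with `?` replaced by `0`. -/
def Entry.toReal : Entry → ℝ
  | none => 0
  | some s => ((s : ℤ) : ℝ)

/-- The exponent `∑_{(i,j) ∈ E} A_ij z_i z_j + ∑_i θ_i z_i`; every undirected edge counts once, and
pairs with `A_ij = 0` (the non-edges) contribute nothing. -/
def energy {n : ℕ} (A : Matrix (Fin n) (Fin n) ℝ) (θ : Fin n → ℝ) (z : Config n) : ℝ :=
  (∑ i, ∑ j ∈ Finset.Ioi i, A i j * ((z i : ℤ) : ℝ) * ((z j : ℤ) : ℝ)) +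
    ∑ i, θ i * ((z i : ℤ) : ℝ)

/-- The Ising model `𝒟(A, θ)` on `{-1, 1}^n`. -/
def isingMeasure {n : ℕ} (A : Matrix (Fin n) (Fin n) ℝ) (θ : Fin n → ℝ) : Measure (Config n) :=
  ∑ z, ENNReal.ofReal (Real.exp (energy A θ z) / ∑ y, Real.exp (energy A θ y)) • Measure.dirac z

/-- The observation obtained from `z` by hiding the entries `i` with `mask i = true`. -/
def corrupt {n : ℕ} (z : Config n) (mask : Fin n → Bool) : Obs n :=
  fun i => if mask i then none else some (z i)

/-- The missing-data law: draw `z` from the Ising model, and hide every entry independently with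
probability `p`. -/
def missLaw {n : ℕ} (A : Matrix (Fin n) (Fin n) ℝ) (θ : Fin n → ℝ) (p : I) : Measure (Obs n) :=
  ((isingMeasure A θ).prod (Measure.pi fun _ : Fin n => bernoulliMeasure true false p)).map
    fun zc => corrupt zc.1 zc.2

/-- The joint law of `T` independent corrupted samples. -/
def samplesLaw {n : ℕ} (A : Matrix (Fin n) (Fin n) ℝ) (θ : Fin n → ℝ) (p : I) (T : ℕ) :
    Measure (Fin T → Obs n) :=
  Measure.pi fun _ : Fin T => missLaw A θ p

/-- Total variation distance `sup_s |μ(s) - ν(s)|` over the measurable sets `s`. -/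
def tvDist {Ω : Type*} [MeasurableSpace Ω] (μ ν : Measure Ω) : ℝ :=
  ⨆ s : {s : Set Ω // MeasurableSet s}, |μ.real s - ν.real s|

/-- The empirical estimate `p̂`: the fraction of `?` among the `m * n` observed entries. -/
def pHat {n m : ℕ} (x : Fin m → Obs n) : ℝ :=
  ((Finset.univ.filter fun ti : Fin m × Fin n => x ti.1 ti.2 = none).card : ℝ) /
    ((m : ℝ) * (n : ℝ))

/-- The `2n - 1` coordinates of the simplex for the neighbourhood of the vertex `v`: two for every
other vertex (positive and negative part of its weight) and one slack coordinate. -/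
abbrev Coord {n : ℕ} (v : Fin n) := ({j : Fin n // j ≠ v} ⊕ {j : Fin n // j ≠ v}) ⊕ Unit

/-- The map from the simplex to the `ℓ₁` ball, `w ↦ (w_i - w_{n-1+i})_i`. -/
def toBall {n : ℕ} {v : Fin n} (w : Coord v → ℝ) (i : {j : Fin n // j ≠ v}) : ℝ :=
  w (.inl (.inl i)) - w (.inl (.inr i))

/-- The estimator `g_miss^i(w; X)` for the vertex `v` and missing probability `p`. -/
def gMiss {n : ℕ} (p : ℝ) (v : Fin n) (w : Coord v → ℝ) (X : Obs n) (i : {j : Fin n // j ≠ v}) :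
    ℝ :=
  -((X v).toReal / (1 - p)) *
    (Real.exp (-(toBall w i * (X v).toReal * (X i).toReal)) * (X i).toReal / (1 - p)) *
    ∏ j ∈ Finset.univ.erase i,
      (Real.exp (-(toBall w j * (X v).toReal * (X j).toReal)) - p) / (1 - p)

/-- The gradient estimator `G_miss(w; X) = ∑_i g_miss^i(w; X) (e^i - e^{n-1+i})`. -/
def gradMiss {n : ℕ} (p : ℝ) (v : Fin n) (w : Coord v → ℝ) (X : Obs n) : Coord v → ℝ
  | .inl (.inl i) => gMiss p v w X i
  | .inl (.inr i) => -gMiss p v w X i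
  | .inr _ => 0

/-- The bound `B = exp(lam / (1 - p)) / (1 - p)^2` on the sup norm of the gradient estimator. -/
def gradBound (lam p : ℝ) : ℝ := Real.exp (lam / (1 - p)) / (1 - p) ^ 2

/-- The step size `η = min {1 / (8 B), (1 / (2 B)) √(log k / T)}` with `k = 2n - 1`. -/
def stepSize (n : ℕ) (lam p : ℝ) (T : ℕ) : ℝ :=
  min (1 / (8 * gradBound lam p))
    (1 / (2 * gradBound lam p) * Real.sqrt (Real.log (2 * (n : ℝ) - 1) / (T : ℝ)))

/-- One multiplicative update on the sample `X`:
`w_i ↦ w_i (1 - η G_i + η C)` with `C = (∑_k w_k G_k) / lam`. -/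
def smgStep {n : ℕ} (lam p η : ℝ) (v : Fin n) (w : Coord v → ℝ) (X : Obs n) : Coord v → ℝ :=
  fun i => w i * (1 - η * gradMiss p v w X i + η * ((∑ k, w k * gradMiss p v w X k) / lam))

/-- The iterate after `t` updates (on the samples `0, …, t - 1`), starting from the uniform point
`lam / (2n - 1)`. -/
def smgIter {n T : ℕ} (lam p η : ℝ) (v : Fin n) (x : Fin T → Obs n) : ℕ → Coord v → ℝ
  | 0 => fun _ => lam / (2 * (n : ℝ) - 1)
  | t + 1 =>
    if h : t < T then smgStep lam p η v (smgIter lam p η v x t) (x ⟨t, h⟩)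
    else smgIter lam p η v x t

/-- The output `w̄` of stochastic multiplicative gradient descent for the vertex `v` on the missing
data `x`, run with missing probability `p`: the average of the first `T` iterates. -/
def smgOutput {n T : ℕ} (lam p : ℝ) (v : Fin n) (x : Fin T → Obs n) : Coord v → ℝ :=
  fun i => (∑ t ∈ Finset.range T, smgIter lam p (stepSize n lam p T) v x t i) / (T : ℝ)

end IsingMissing

end

/-! Part 4 needs no analysis of the algorithm run with a wrong missing probability. Once the first
block of samples is fixed, the estimate is a number `q`; one analyses the algorithm with parameter
`q` on data that really have missing probability `q`, and then replaces the law of the data by the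
true one, at a cost in total variation.

The statistical half rests on a factorisation: the likelihood of `T` corrupted samples is `p ^ k *
(1 - p) ^ (n * T - k)` times a weight free of `p`, where `k` counts the missing entries
(`samplesLaw_real_singleton`). So the count is a sufficient statistic, with a binomial law.
Likelihood-ratio sets depend on the count alone, which reduces total variation to binomials
(`tvDist_samplesLaw`). The χ² divergence is explicit and is of order `δ ^ 2` when `|q - p| ≤ δ / √(T
n)` (`abs_samplesLaw_sub_le_const`). Hoeffding's bound for the count gives the accuracy of the
estimate (`pHat_accurate`).

The optimisation half concerns the interaction screening objective `E exp (-∑ w_j z_v z_j)`, convex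
in `w`. The estimator `gMiss` is unbiased for its gradient (`meanGrad_eq`), and this gradient
vanishes at the true row of `A`. Flipping one spin shows enough curvature to control each coordinate
of the error (`le_sum_mul_meanGrad`). The inner products of the errors with the mean gradients are
bounded by the regret of the multiplicative updates (`smg_regret`) plus a martingale
(`measureReal_martingale_ge_le`). Both are of order `√T`, so the squared error of the average
iterate is of order `1 / √T`, hence the power `ε ^ (-4)` in the sample size. -/

noncomputable section

namespace IsingMissing

/-! ### Point masses of the laws -/

/-- The probability of a spin configuration in the Ising model. -/
def spinWeight {n : ℕ} (A : Matrix (Fin n) (Fin n) ℝ) (θ : Fin n → ℝ) (z : Config n) : ℝ :=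
  Real.exp (energy A θ z) / ∑ y, Real.exp (energy A θ y)

lemma spinWeight_pos {n : ℕ} (A : Matrix (Fin n) (Fin n) ℝ) (θ : Fin n → ℝ) (z : Config n) :
    0 < spinWeight A θ z :=
  div_pos (Real.exp_pos _) (Finset.sum_pos (fun _ _ => Real.exp_pos _) Finset.univ_nonempty)

lemma sum_spinWeight {n : ℕ} (A : Matrix (Fin n) (Fin n) ℝ) (θ : Fin n → ℝ) :
    ∑ z, spinWeight A θ z = 1 := by
  unfold spinWeight
  rw [← Finset.sum_div, div_self]
  exact (Finset.sum_pos (fun _ _ => Real.exp_pos _) Finset.univ_nonempty).ne'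

lemma isingMeasure_singleton {n : ℕ} (A : Matrix (Fin n) (Fin n) ℝ) (θ : Fin n → ℝ)
    (z : Config n) : isingMeasure A θ {z} = ENNReal.ofReal (spinWeight A θ z) := by
  unfold isingMeasure
  rw [Measure.finsetSum_apply, Finset.sum_eq_single z]
  · simp [spinWeight]
  · intro y _ hy
    simp [hy]
  · simp

instance {n : ℕ} (A : Matrix (Fin n) (Fin n) ℝ) (θ : Fin n → ℝ) :
    IsProbabilityMeasure (isingMeasure A θ) := ⟨by
  have h := sum_measure_singleton (μ := isingMeasure A θ) (s := Finset.univ)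
  rw [Finset.coe_univ] at h
  rw [← h]
  simp_rw [isingMeasure_singleton]
  rw [← ENNReal.ofReal_sum_of_nonneg fun z _ => (spinWeight_pos A θ z).le, sum_spinWeight,
    ENNReal.ofReal_one]⟩

instance {n : ℕ} (A : Matrix (Fin n) (Fin n) ℝ) (θ : Fin n → ℝ) (p : I) :
    IsProbabilityMeasure (missLaw A θ p) :=
  Measure.isProbabilityMeasure_map (Measurable.of_discrete).aemeasurable

instance {n : ℕ} (A : Matrix (Fin n) (Fin n) ℝ) (θ : Fin n → ℝ) (p : I) (T : ℕ) :
    IsProbabilityMeasure (samplesLaw A θ p T) := by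
  unfold samplesLaw; infer_instance

lemma measureReal_pi_singleton {ι : Type*} [Fintype ι] {α : Type*} [MeasurableSpace α]
    (μ : ι → Measure α) [∀ i, SigmaFinite (μ i)] (x : ι → α) :
    (Measure.pi μ).real {x} = ∏ i, (μ i).real {x i} := by
  simp [measureReal_def, ENNReal.toReal_prod]

lemma measureReal_eq_sum {α : Type*} [Fintype α] [MeasurableSpace α]
    [MeasurableSingletonClass α] (μ : Measure α) [IsFiniteMeasure μ] (s : Set α)
    [DecidablePred (· ∈ s)] :
    μ.real s = ∑ x, if x ∈ s then μ.real {x} else 0 := by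
  rw [← Finset.sum_filter, sum_measureReal_singleton]
  simp

lemma sum_measureReal_univ {α : Type*} [Fintype α] [MeasurableSpace α]
    [MeasurableSingletonClass α] (μ : Measure α) [IsProbabilityMeasure μ] :
    ∑ x, μ.real {x} = 1 := by
  rw [sum_measureReal_singleton]
  simp

lemma bernoulliMeasure_bool_real (p : I) (b : Bool) :
    (bernoulliMeasure true false p).real {b} = if b then (p : ℝ) else 1 - p := by
  cases b <;> simp

/-- Expectations under the missing-data law. -/
lemma missLaw_sum {n : ℕ} (A : Matrix (Fin n) (Fin n) ℝ) (θ : Fin n → ℝ) (p : I)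
    (f : Obs n → ℝ) :
    ∑ x, (missLaw A θ p).real {x} * f x =
      ∑ z, spinWeight A θ z *
        ∑ c : Fin n → Bool, (∏ i, if c i then (p : ℝ) else 1 - p) * f (corrupt z c) := by
  have h1 : ∑ x, (missLaw A θ p).real {x} * f x = ∫ x, f x ∂(missLaw A θ p) := by
    rw [integral_fintype (Integrable.of_finite)]; rfl
  rw [h1, missLaw, integral_map (Measurable.of_discrete).aemeasurable
    (StronglyMeasurable.of_discrete).aestronglyMeasurable, integral_fintype (Integrable.of_finite),
    Fintype.sum_prod_type]
  refine Finset.sum_congr rfl fun z _ => ?_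
  rw [Finset.mul_sum]
  refine Finset.sum_congr rfl fun c _ => ?_
  rw [← Set.singleton_prod_singleton, measureReal_prod_prod, measureReal_pi_singleton,
    measureReal_def, isingMeasure_singleton, ENNReal.toReal_ofReal (spinWeight_pos A θ z).le]
  simp only [bernoulliMeasure_bool_real, smul_eq_mul, mul_assoc]

/-- An observed entry is compatible with a spin if it is missing or shows the spin. -/
def compat (e : Entry) (s : ℤˣ) : ℝ := if e = none ∨ e = some s then 1 else 0

/-- The probability that the spins shown by an observation are those of the model. -/
def shownWeight {n : ℕ} (A : Matrix (Fin n) (Fin n) ℝ) (θ : Fin n → ℝ) (x : Obs n) : ℝ :=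
  ∑ z, spinWeight A θ z * ∏ i, compat (x i) (z i)

lemma compat_nonneg (e : Entry) (s : ℤˣ) : 0 ≤ compat e s := by
  unfold compat; split_ifs <;> norm_num

lemma shownWeight_nonneg {n : ℕ} (A : Matrix (Fin n) (Fin n) ℝ) (θ : Fin n → ℝ) (x : Obs n) :
    0 ≤ shownWeight A θ x :=
  Finset.sum_nonneg fun z _ => mul_nonneg (spinWeight_pos A θ z).le
    (Finset.prod_nonneg fun _ _ => compat_nonneg _ _)

lemma sum_prod_bool {ι R : Type*} [Fintype ι] [DecidableEq ι] [CommSemiring R]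
    (f : ι → Bool → R) : ∑ c : ι → Bool, ∏ i, f i (c i) = ∏ i, (f i true + f i false) := by
  have h := Finset.prod_univ_sum (fun _ : ι => (Finset.univ : Finset Bool)) f
  rw [Fintype.piFinset_univ] at h
  rw [← h]
  simp

/-- The sum over masks factors over coordinates, and for each entry compatible with the spin exactly
one mask value produces it. All dependence on `p` sits in the first product. -/
lemma missLaw_real_singleton {n : ℕ} (A : Matrix (Fin n) (Fin n) ℝ) (θ : Fin n → ℝ) (p : I)
    (x : Obs n) :
    (missLaw A θ p).real {x} =
      (∏ i, if x i = none then (p : ℝ) else 1 - p) * shownWeight A θ x := by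
  have h := missLaw_sum A θ p fun y => if y = x then 1 else 0
  simp only [mul_ite, mul_one, mul_zero, Finset.sum_ite_eq', Finset.mem_univ, if_true] at h
  rw [h, shownWeight, Finset.mul_sum]
  refine Finset.sum_congr rfl fun z _ => ?_
  rw [mul_left_comm]
  congr 1
  rw [← Finset.prod_mul_distrib]
  have hc : ∀ c : Fin n → Bool,
      (if corrupt z c = x then (∏ i, if c i then (p : ℝ) else 1 - p) else 0) =
        ∏ i, ((if c i then (p : ℝ) else 1 - p) *
          if (if c i then none else some (z i)) = x i then 1 else 0) := by
    intro c
    rw [Finset.prod_mul_distrib, Finset.prod_boole]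
    simp [funext_iff, corrupt]
  rw [Finset.sum_congr rfl fun c _ => hc c,
    sum_prod_bool fun i b => (if b then (p : ℝ) else 1 - p) *
      if (if b then none else some (z i)) = x i then 1 else 0]
  refine Finset.prod_congr rfl fun i _ => ?_
  unfold compat
  rcases hx : x i with _ | s
  · simp
  · simp [eq_comm]

/-! ### The number of missing entries -/

/-- The number of missing entries among the entries of several observations. -/
def missCount {n m : ℕ} (x : Fin m → Obs n) : ℕ :=
  (Finset.univ.filter fun ti : Fin m × Fin n => x ti.1 ti.2 = none).card

lemma missCount_le {n m : ℕ} (x : Fin m → Obs n) : missCount x ≤ n * m := by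
  refine (Finset.card_le_univ _).trans ?_
  simp [mul_comm]

lemma pHat_eq {n m : ℕ} (x : Fin m → Obs n) :
    pHat x = (missCount x : ℝ) / ((m : ℝ) * (n : ℝ)) := rfl

lemma prod_missing {n m : ℕ} (x : Fin m → Obs n) (a b : ℝ) :
    ∏ t, ∏ i, (if x t i = none then a else b) =
      a ^ missCount x * b ^ (n * m - missCount x) := by
  rw [← Fintype.prod_prod_type', Finset.prod_ite, Finset.prod_const, Finset.prod_const]
  congr 2
  have h := Finset.card_filter_add_card_filter_not (s := Finset.univ)
    (fun ti : Fin m × Fin n => x ti.1 ti.2 = none)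
  simp only [Finset.card_univ, Fintype.card_prod, Fintype.card_fin] at h
  rw [mul_comm n m, ← h, missCount, Nat.add_sub_cancel_left]

lemma samplesLaw_real_singleton {n m : ℕ} (A : Matrix (Fin n) (Fin n) ℝ) (θ : Fin n → ℝ) (p : I)
    (x : Fin m → Obs n) :
    (samplesLaw A θ p m).real {x} =
      (p : ℝ) ^ missCount x * (1 - p : ℝ) ^ (n * m - missCount x) * ∏ t, shownWeight A θ (x t) := by
  rw [samplesLaw, measureReal_pi_singleton, ← prod_missing, ← Finset.prod_mul_distrib]
  exact Finset.prod_congr rfl fun t _ => missLaw_real_singleton A θ p (x t)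

/-- A generating function with free real `r` and `s`, not only probabilities: it later yields the
binomial coefficients, the χ² sum and the exponential moments of the count. -/
lemma sum_shownWeight_mul_pow {n : ℕ} (A : Matrix (Fin n) (Fin n) ℝ) (θ : Fin n → ℝ) (r s : ℝ) :
    ∑ x, (∏ i, if x i = none then r else s) * shownWeight A θ x = (r + s) ^ n := by
  simp_rw [shownWeight, Finset.mul_sum]
  rw [Finset.sum_comm]
  have h : ∀ z : Config n, ∑ x : Obs n, (∏ i, if x i = none then r else s) *
      (spinWeight A θ z * ∏ i, compat (x i) (z i)) = spinWeight A θ z * (r + s) ^ n := by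
    intro z
    have h1 := Finset.prod_univ_sum (fun _ : Fin n => (Finset.univ : Finset Entry))
      fun i e => (if e = none then r else s) * compat e (z i)
    rw [Fintype.piFinset_univ] at h1
    have h2 : ∀ i : Fin n,
        ∑ e : Entry, (if e = none then r else s) * compat e (z i) = r + s := by
      intro i
      rw [Fintype.sum_option, ← Finset.sum_erase_add _ _ (Finset.mem_univ (z i)),
        Finset.sum_eq_zero]
      · simp [compat]
      · intro e he
        simp [compat, Finset.ne_of_mem_erase he]
    simp_rw [h2, Finset.prod_const, Finset.card_univ, Fintype.card_fin] at h1
    rw [h1, Finset.mul_sum]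
    refine Finset.sum_congr rfl fun x _ => ?_
    rw [Finset.prod_mul_distrib]
    ring
  simp_rw [h]
  rw [← Finset.sum_mul, sum_spinWeight, one_mul]

lemma sum_prod_shownWeight_mul_pow {n m : ℕ} (A : Matrix (Fin n) (Fin n) ℝ) (θ : Fin n → ℝ)
    (r s : ℝ) :
    ∑ x : Fin m → Obs n, r ^ missCount x * s ^ (n * m - missCount x) *
      ∏ t, shownWeight A θ (x t) = (r + s) ^ (n * m) := by
  have h1 := Finset.prod_univ_sum (fun _ : Fin m => (Finset.univ : Finset (Obs n)))
      fun _ x => (∏ i, if x i = none then r else s) * shownWeight A θ x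
  rw [Fintype.piFinset_univ] at h1
  simp_rw [sum_shownWeight_mul_pow, Finset.prod_const, Finset.card_univ, Fintype.card_fin] at h1
  rw [pow_mul, h1]
  refine Finset.sum_congr rfl fun x _ => ?_
  rw [Finset.prod_mul_distrib, prod_missing]

/-- Compare coefficients in the previous identity at `s = 1`, read as an identity of polynomials in
`r`. -/
lemma sum_prod_shownWeight_missCount {n m : ℕ} (A : Matrix (Fin n) (Fin n) ℝ) (θ : Fin n → ℝ)
    (k : ℕ) :
    ∑ x : Fin m → Obs n, (if missCount x = k then ∏ t, shownWeight A θ (x t) else 0) =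
      ((n * m).choose k : ℝ) := by
  have h : ∑ x : Fin m → Obs n, Polynomial.C (∏ t, shownWeight A θ (x t)) *
      Polynomial.X ^ missCount x = (Polynomial.X + 1 : Polynomial ℝ) ^ (n * m) := by
    refine Polynomial.funext fun r => ?_
    simp only [Polynomial.eval_finsetSum, Polynomial.eval_mul, Polynomial.eval_C,
      Polynomial.eval_pow, Polynomial.eval_X, Polynomial.eval_add, Polynomial.eval_one]
    rw [← sum_prod_shownWeight_mul_pow A θ r 1]
    exact Finset.sum_congr rfl fun x _ => by rw [one_pow, mul_one, mul_comm]
  have hk := congrArg (fun P => Polynomial.coeff P k) h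
  simp only [Polynomial.finsetSum_coeff, Polynomial.coeff_C_mul_X_pow,
    Polynomial.coeff_X_add_one_pow] at hk
  rw [← hk]
  exact Finset.sum_congr rfl fun x _ => by simp only [eq_comm]

/-- The number of missing entries follows a binomial law. -/
lemma map_missCount_samplesLaw {n m : ℕ} (A : Matrix (Fin n) (Fin n) ℝ) (θ : Fin n → ℝ) (p : I) :
    (samplesLaw A θ p m).map missCount = binomial (n * m) p := by
  classical
  have : IsProbabilityMeasure ((samplesLaw A θ p m).map missCount) :=
    Measure.isProbabilityMeasure_map (Measurable.of_discrete).aemeasurable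
  refine Measure.ext_of_measureReal_singleton fun k => ?_
  rw [map_measureReal_apply Measurable.of_discrete (measurableSet_singleton k),
    binomial_real_singleton, measureReal_eq_sum, ← sum_prod_shownWeight_missCount A θ k,
    mul_assoc, Finset.sum_mul]
  refine Finset.sum_congr rfl fun x _ => ?_
  rw [samplesLaw_real_singleton]
  by_cases hx : missCount x = k
  · simp only [Set.mem_preimage, Set.mem_singleton_iff, hx, if_true]
    ring
  · simp [hx]

/-! ### Total variation distance -/

lemma abs_sub_le_tvDist {Ω : Type*} [MeasurableSpace Ω] (μ ν : Measure Ω)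
    [IsProbabilityMeasure μ] [IsProbabilityMeasure ν] {s : Set Ω} (hs : MeasurableSet s) :
    |μ.real s - ν.real s| ≤ tvDist μ ν := by
  refine le_ciSup (f := fun s : {s : Set Ω // MeasurableSet s} => |μ.real s - ν.real s|)
    ⟨1, ?_⟩ ⟨s, hs⟩
  rintro _ ⟨t, rfl⟩
  exact abs_sub_le_of_nonneg_of_le measureReal_nonneg measureReal_le_one measureReal_nonneg
    measureReal_le_one

lemma tvDist_le {Ω : Type*} [MeasurableSpace Ω] {μ ν : Measure Ω} {c : ℝ}
    (h : ∀ s, MeasurableSet s → |μ.real s - ν.real s| ≤ c) : tvDist μ ν ≤ c := by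
  have : Nonempty {s : Set Ω // MeasurableSet s} := ⟨⟨∅, MeasurableSet.empty⟩⟩
  exact ciSup_le fun s => h s s.2

lemma tvDist_comm {Ω : Type*} [MeasurableSpace Ω] (μ ν : Measure Ω) :
    tvDist μ ν = tvDist ν μ := by
  unfold tvDist
  simp_rw [abs_sub_comm]

/-- Neyman–Pearson: the difference is largest on the set where the likelihood under `p` is at least
that under `q`. The common factor `shownWeight` cancels from this comparison, so the set is a
preimage under `missCount`. -/
lemma samplesLaw_sub_le_tvDist_binomial {n T : ℕ} (A : Matrix (Fin n) (Fin n) ℝ) (θ : Fin n → ℝ)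
    (p q : I) (S : Set (Fin T → Obs n)) :
    (samplesLaw A θ p T).real S - (samplesLaw A θ q T).real S ≤
      tvDist (binomial (n * T) p) (binomial (n * T) q) := by
  classical
  set b : I → ℕ → ℝ := fun p k => (p : ℝ) ^ k * (1 - p : ℝ) ^ (n * T - k)
  set R : Set ℕ := {k | b q k ≤ b p k}
  refine le_trans ?_ ((le_abs_self _).trans
    (abs_sub_le_tvDist (binomial (n * T) p) (binomial (n * T) q) (s := R) .of_discrete))
  rw [← map_missCount_samplesLaw A θ p, ← map_missCount_samplesLaw A θ q,
    map_measureReal_apply Measurable.of_discrete .of_discrete,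
    map_measureReal_apply Measurable.of_discrete .of_discrete]
  rw [measureReal_eq_sum (samplesLaw A θ p T) S, measureReal_eq_sum (samplesLaw A θ q T) S,
    measureReal_eq_sum (samplesLaw A θ p T) (missCount ⁻¹' R),
    measureReal_eq_sum (samplesLaw A θ q T) (missCount ⁻¹' R), ← Finset.sum_sub_distrib,
    ← Finset.sum_sub_distrib]
  refine Finset.sum_le_sum fun x _ => ?_
  simp_rw [samplesLaw_real_singleton]
  have hh : 0 ≤ ∏ t, shownWeight A θ (x t) := Finset.prod_nonneg fun t _ => shownWeight_nonneg A θ _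
  have hm : x ∈ missCount ⁻¹' R ↔ b q (missCount x) ≤ b p (missCount x) := Iff.rfl
  simp only [hm]
  change (if x ∈ S then b p (missCount x) * _ else 0) - (if x ∈ S then b q (missCount x) * _ else 0)
    ≤ (if _ then b p (missCount x) * _ else 0) - (if _ then b q (missCount x) * _ else 0)
  split_ifs with h1 h2 h2
  · exact le_rfl
  · nlinarith [mul_le_mul_of_nonneg_right (not_le.mp h2).le hh]
  · nlinarith [mul_le_mul_of_nonneg_right h2 hh]
  · exact le_rfl

lemma tvDist_samplesLaw {n T : ℕ} (A : Matrix (Fin n) (Fin n) ℝ) (θ : Fin n → ℝ) (p q : I) :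
    tvDist (samplesLaw A θ p T) (samplesLaw A θ q T) =
      tvDist (binomial (n * T) p) (binomial (n * T) q) := by
  refine le_antisymm (tvDist_le fun S _ => abs_sub_le_iff.mpr
    ⟨samplesLaw_sub_le_tvDist_binomial A θ p q S, ?_⟩) (tvDist_le fun s hs => ?_)
  · rw [tvDist_comm]
    exact samplesLaw_sub_le_tvDist_binomial A θ q p S
  -- The reverse inequality is data processing through `missCount`.
  · rw [← map_missCount_samplesLaw A θ p, ← map_missCount_samplesLaw A θ q,
      map_measureReal_apply Measurable.of_discrete hs,
      map_measureReal_apply Measurable.of_discrete hs]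
    exact abs_sub_le_tvDist _ _ .of_discrete

/-- The total variation distance is at most the square root of the `χ²` divergence. -/
lemma abs_samplesLaw_sub_le {n T : ℕ} (A : Matrix (Fin n) (Fin n) ℝ) (θ : Fin n → ℝ)
    (p q : I) (hp0 : 0 < (p : ℝ)) (hp1 : (p : ℝ) < 1) (S : Set (Fin T → Obs n)) :
    |(samplesLaw A θ p T).real S - (samplesLaw A θ q T).real S| ≤
      √((1 + ((q : ℝ) - p) ^ 2 / (p * (1 - p))) ^ (n * T) - 1) := by
  classical
  have hp1' : (0 : ℝ) < 1 - p := by linarith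
  set h : (Fin T → Obs n) → ℝ := fun x => ∏ t, shownWeight A θ (x t)
  have hh : ∀ x, 0 ≤ h x := fun x => Finset.prod_nonneg fun t _ => shownWeight_nonneg A θ _
  set b : I → (Fin T → Obs n) → ℝ :=
    fun p x => (p : ℝ) ^ missCount x * (1 - p : ℝ) ^ (n * T - missCount x)
  have hb : ∀ x, 0 < b p x := fun x => mul_pos (pow_pos hp0 _) (pow_pos hp1' _)
  have hP : ∀ (p : I) x, (samplesLaw A θ p T).real {x} = b p x * h x :=
    fun p x => samplesLaw_real_singleton A θ p x
  have hsum : ∀ p : I, ∑ x, b p x * h x = 1 := fun p => by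
    simp_rw [← hP, sum_measureReal_univ]
  have h1 : |(samplesLaw A θ p T).real S - (samplesLaw A θ q T).real S| ≤
      ∑ x, |b p x - b q x| * h x := by
    rw [measureReal_eq_sum, measureReal_eq_sum, ← Finset.sum_sub_distrib]
    refine (Finset.abs_sum_le_sum_abs _ _).trans (Finset.sum_le_sum fun x _ => ?_)
    split_ifs
    · rw [hP, hP, ← sub_mul, abs_mul, abs_of_nonneg (hh x)]
    · simpa using mul_nonneg (abs_nonneg _) (hh x)
  -- One plus the χ² divergence, from the generating function at `r = q ^ 2 / p` and `s = (1 - q) ^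
  -- 2 / (1 - p)`.
  have h2 : ∑ x, (b q x) ^ 2 / b p x * h x =
      (1 + ((q : ℝ) - p) ^ 2 / (p * (1 - p))) ^ (n * T) := by
    have e : 1 + ((q : ℝ) - p) ^ 2 / (p * (1 - p)) =
        (q : ℝ) ^ 2 / p + (1 - q : ℝ) ^ 2 / (1 - p) := by
      field_simp
      ring
    rw [e, ← sum_prod_shownWeight_mul_pow A θ]
    refine Finset.sum_congr rfl fun x _ => ?_
    simp only [b, h, div_pow, mul_pow, div_mul_div_comm, ← pow_mul, mul_comm 2]
  have h3 : ∑ x, (b p x - b q x) ^ 2 / b p x * h x =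
      (1 + ((q : ℝ) - p) ^ 2 / (p * (1 - p))) ^ (n * T) - 1 := by
    have e : ∀ x, (b p x - b q x) ^ 2 / b p x * h x =
        b p x * h x - 2 * (b q x * h x) + (b q x) ^ 2 / b p x * h x := fun x => by
      have := (hb x).ne'
      field_simp
      ring
    simp_rw [e, Finset.sum_add_distrib, Finset.sum_sub_distrib, ← Finset.mul_sum, hsum, h2]
    ring
  refine h1.trans (Real.le_sqrt_of_sq_le ?_)
  -- Cauchy–Schwarz splits `|b p - b q| * h` into the square roots of `b p * h`, of total mass one,
  -- and of the χ² summand.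
  have h4 := Finset.sum_mul_sq_le_sq_mul_sq Finset.univ
    (fun x => √(b p x * h x)) (fun x => √((b p x - b q x) ^ 2 / b p x * h x))
  have h5 : ∀ x, 0 ≤ b p x * h x := fun x => mul_nonneg (hb x).le (hh x)
  have h6 : ∀ x, 0 ≤ (b p x - b q x) ^ 2 / b p x * h x :=
    fun x => mul_nonneg (div_nonneg (sq_nonneg _) (hb x).le) (hh x)
  simp_rw [Real.sq_sqrt (h5 _), Real.sq_sqrt (h6 _), hsum, h3, one_mul] at h4
  refine le_trans (le_of_eq ?_) h4
  congr 1
  refine Finset.sum_congr rfl fun x _ => ?_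
  rw [← Real.sqrt_mul (h5 x)]
  have : b p x * h x * ((b p x - b q x) ^ 2 / b p x * h x) = ((b p x - b q x) * h x) ^ 2 := by
    have := (hb x).ne'
    field_simp
  rw [this, Real.sqrt_sq_eq_abs, abs_mul, abs_of_nonneg (hh x)]

/-- The constant of the total variation bound. -/
def tvConst (p : ℝ) : ℝ := √(Real.exp (1 / (p * (1 - p))))

lemma abs_samplesLaw_sub_le_const {n T : ℕ} (hn : 1 ≤ n) (hT : 1 ≤ T)
    (A : Matrix (Fin n) (Fin n) ℝ) (θ : Fin n → ℝ)
    (p q : I) (hp0 : 0 < (p : ℝ)) (hp1 : (p : ℝ) < 1) {δ : ℝ} (hδ0 : 0 < δ) (hδ1 : δ < 1)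
    (hq : |(q : ℝ) - p| ≤ δ / √((T : ℝ) * n)) (S : Set (Fin T → Obs n)) :
    |(samplesLaw A θ p T).real S - (samplesLaw A θ q T).real S| ≤ tvConst p * δ := by
  refine (abs_samplesLaw_sub_le A θ p q hp0 hp1 S).trans ?_
  have hN : (0 : ℝ) < (T : ℝ) * n := by positivity
  have hpp : (0 : ℝ) < p * (1 - p) := mul_pos hp0 (by linarith)
  set a : ℝ := 1 / (p * (1 - p)) with ha
  have ha0 : 0 < a := by positivity
  have h1 : ((q : ℝ) - p) ^ 2 ≤ δ ^ 2 / (T * n) := by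
    rw [← sq_abs]
    refine (pow_le_pow_left₀ (abs_nonneg _) hq 2).trans (le_of_eq ?_)
    rw [div_pow, Real.sq_sqrt hN.le]
  have h2 : (1 + ((q : ℝ) - p) ^ 2 / (p * (1 - p))) ^ (n * T) ≤ Real.exp (δ ^ 2 * a) := by
    have h3 : 1 + ((q : ℝ) - p) ^ 2 / (p * (1 - p)) ≤ Real.exp (δ ^ 2 / (T * n) * a) := by
      refine le_trans ?_ (Real.add_one_le_exp _)
      rw [add_comm, div_eq_mul_one_div]
      gcongr
    refine (pow_le_pow_left₀ (by positivity) h3 _).trans (le_of_eq ?_)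
    rw [← Real.exp_nat_mul]
    congr 1
    push_cast
    field_simp
  -- The chord of `exp` over `[0, a]` at `δ ^ 2 ≤ 1`: after subtracting one, a factor `δ ^ 2` comes
  -- out, and the square root is linear in `δ`.
  have h4 : Real.exp (δ ^ 2 * a) ≤ (1 - δ ^ 2) + δ ^ 2 * Real.exp a := by
    have hd : δ ^ 2 ≤ 1 := by nlinarith
    have := convexOn_exp.2 (Set.mem_univ 0) (Set.mem_univ a) (sub_nonneg.mpr hd) (sq_nonneg δ)
      (by ring)
    simpa using this
  rw [tvConst, ← Real.sqrt_sq hδ0.le, ← Real.sqrt_mul (Real.exp_pos _).le]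
  refine Real.sqrt_le_sqrt ?_
  nlinarith [sq_nonneg δ]

/-! ### Tail bounds -/

lemma exp_mul_le_cosh_add {s x : ℝ} (hx : |x| ≤ 1) :
    Real.exp (s * x) ≤ Real.cosh s + x * Real.sinh s := by
  obtain ⟨h1, h2⟩ := abs_le.mp hx
  have h := convexOn_exp.2 (Set.mem_univ s) (Set.mem_univ (-s))
    (show 0 ≤ (1 + x) / 2 by linarith) (show 0 ≤ (1 - x) / 2 by linarith) (by ring)
  simp only [smul_eq_mul] at h
  rw [Real.cosh_eq, Real.sinh_eq]
  calc Real.exp (s * x) = Real.exp ((1 + x) / 2 * s + (1 - x) / 2 * -s) := by congr 1; ring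
    _ ≤ _ := h
    _ = _ := by ring

/-- Hoeffding's lemma for weights on a finite type. -/
lemma sum_mul_exp_le {X : Type*} [Fintype X] {P D : X → ℝ} {c : ℝ} (s : ℝ) (hc : 0 < c)
    (hP : ∀ x, 0 ≤ P x) (hP1 : ∑ x, P x = 1) (hD : ∀ x, |D x| ≤ c)
    (h0 : ∑ x, P x * D x = 0) :
    ∑ x, P x * Real.exp (s * D x) ≤ Real.exp (s ^ 2 * c ^ 2 / 2) := by
  have h : ∀ x, P x * Real.exp (s * D x) ≤
      P x * Real.cosh (s * c) + P x * D x * (Real.sinh (s * c) / c) := fun x => by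
    have hx : |D x / c| ≤ 1 := by
      rw [abs_div, abs_of_pos hc]
      exact (div_le_one hc).mpr (hD x)
    have h1 := mul_le_mul_of_nonneg_left (exp_mul_le_cosh_add (s := s * c) hx) (hP x)
    have h2 : s * c * (D x / c) = s * D x := by field_simp
    rw [h2] at h1
    refine h1.trans (le_of_eq ?_)
    ring
  refine (Finset.sum_le_sum fun x _ => h x).trans ?_
  rw [Finset.sum_add_distrib, ← Finset.sum_mul, ← Finset.sum_mul, hP1, h0, one_mul, zero_mul,
    add_zero]
  refine (Real.cosh_le_exp_half_sq _).trans (le_of_eq ?_)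
  congr 1
  ring

/-- Chernoff's bound at `s = a / V`, the minimiser of `s ^ 2 * V / 2 - s * a`. -/
lemma measureReal_ge_le_of_subgaussian {X : Type*} [Fintype X] [MeasurableSpace X]
    [MeasurableSingletonClass X] (μ : Measure X) [IsFiniteMeasure μ] {Y : X → ℝ} {V a : ℝ}
    (hV : 0 < V) (ha : 0 ≤ a)
    (h : ∀ s, ∑ x, μ.real {x} * Real.exp (s * Y x) ≤ Real.exp (s ^ 2 * V / 2)) :
    μ.real {x | a ≤ Y x} ≤ Real.exp (-(a ^ 2 / (2 * V))) := by
  classical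
  have hs : 0 ≤ a / V := by positivity
  have h1 : μ.real {x | a ≤ Y x} ≤
      Real.exp (-(a / V * a)) * ∑ x, μ.real {x} * Real.exp (a / V * Y x) := by
    rw [measureReal_eq_sum, Finset.mul_sum]
    refine Finset.sum_le_sum fun x _ => ?_
    rw [mul_left_comm, ← Real.exp_add]
    split_ifs with hx
    · refine le_mul_of_one_le_right measureReal_nonneg (Real.one_le_exp ?_)
      have := mul_le_mul_of_nonneg_left (show a ≤ Y x from hx) hs
      linarith
    · positivity
  refine h1.trans ((mul_le_mul_of_nonneg_left (h _) (Real.exp_pos _).le).trans (le_of_eq ?_))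
  rw [← Real.exp_add]
  congr 1
  field_simp
  ring

/-- The exponential tilt is absorbed into the free parameters of the generating function, so the
moment is the `n * m`-th power of that of a single centred Bernoulli variable. -/
lemma subgaussian_missCount {n m : ℕ} (A : Matrix (Fin n) (Fin n) ℝ) (θ : Fin n → ℝ) (p : I)
    (s : ℝ) :
    ∑ x, (samplesLaw A θ p m).real {x} * Real.exp (s * ((missCount x : ℝ) - (n * m : ℕ) * p)) ≤
      Real.exp (s ^ 2 * (n * m : ℕ) / 2) := by
  have hp0 : (0 : ℝ) ≤ p := p.2.1
  have hp1 : (0 : ℝ) ≤ 1 - p := sub_nonneg.mpr p.2.2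
  have h1 : ∀ x, (samplesLaw A θ p m).real {x} *
      Real.exp (s * ((missCount x : ℝ) - (n * m : ℕ) * p)) =
      ((p : ℝ) * Real.exp (s * (1 - p))) ^ missCount x *
        ((1 - p : ℝ) * Real.exp (s * -p)) ^ (n * m - missCount x) *
        ∏ t, shownWeight A θ (x t) := fun x => by
    rw [samplesLaw_real_singleton, mul_pow, mul_pow, ← Real.exp_nat_mul, ← Real.exp_nat_mul,
      Nat.cast_sub (missCount_le x)]
    have : s * ((missCount x : ℝ) - (n * m : ℕ) * p) = (missCount x : ℝ) * (s * (1 - p)) +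
        (((n * m : ℕ) : ℝ) - missCount x) * (s * -p) := by ring
    rw [this, Real.exp_add]
    ring
  simp_rw [h1, sum_prod_shownWeight_mul_pow]
  have h2 := sum_mul_exp_le (P := fun b : Bool => if b then (p : ℝ) else 1 - p)
    (D := fun b : Bool => if b then (1 - p : ℝ) else -p) s one_pos (by simp [hp0, p.2.2]) (by simp)
    (by simp [abs_le]; constructor <;> constructor <;> linarith) (by simp; ring)
  simp only [Fintype.sum_bool, if_true, Bool.false_eq_true, if_false] at h2
  refine (pow_le_pow_left₀ (by positivity) h2 _).trans (le_of_eq ?_)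
  rw [← Real.exp_nat_mul]
  congr 1
  ring

/-- Accuracy of the empirical fraction of missing entries. -/
lemma pHat_accurate {n T m : ℕ} (hn : 1 ≤ n) (hT : 1 ≤ T) (A : Matrix (Fin n) (Fin n) ℝ)
    (θ : Fin n → ℝ) (p : I) {δ : ℝ} (hδ0 : 0 < δ) (hδ1 : δ < 1)
    (hm : 2 * ((T : ℝ) / δ ^ 2) * Real.log (2 / δ) ≤ (m : ℝ)) :
    1 - δ ≤ (samplesLaw A θ p m).real {x | |pHat x - (p : ℝ)| ≤ δ / √((T : ℝ) * n)} := by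
  have hn' : (0 : ℝ) < n := by positivity
  have hT' : (0 : ℝ) < T := by positivity
  have hlog : 0 < Real.log (2 / δ) := Real.log_pos (by rw [lt_div_iff₀ hδ0]; linarith)
  have hm' : (0 : ℝ) < m := lt_of_lt_of_le (by positivity) hm
  set N : ℝ := ((n * m : ℕ) : ℝ) with hN
  have hNe : N = n * m := by rw [hN]; push_cast; ring
  have hN0 : 0 < N := by rw [hNe]; positivity
  set μ := samplesLaw A θ p m
  set a : ℝ := N * (δ / √((T : ℝ) * n)) with ha
  have ha0 : 0 ≤ a := by positivity
  -- The exponent equals `m * δ ^ 2 / (2 * T)`; asking that it reach `log (2 / δ)` is where the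
  -- constant `2` in the condition on `m` comes from.
  have hexp : Real.exp (-(a ^ 2 / (2 * N))) ≤ δ / 2 := by
    have h1 : a ^ 2 / (2 * N) = m * δ ^ 2 / (2 * T) := by
      rw [ha, mul_pow, div_pow, Real.sq_sqrt (by positivity), hNe]
      field_simp
    have h2 : Real.log (2 / δ) ≤ m * δ ^ 2 / (2 * T) := by
      rw [le_div_iff₀ (by positivity)]
      have h3 := mul_le_mul_of_nonneg_right hm (sq_nonneg δ)
      have h4 : 2 * ((T : ℝ) / δ ^ 2) * Real.log (2 / δ) * δ ^ 2 = Real.log (2 / δ) * (2 * T) := by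
        field_simp
      linarith
    calc Real.exp (-(a ^ 2 / (2 * N))) ≤ Real.exp (-Real.log (2 / δ)) := by
          rw [h1]; exact Real.exp_le_exp.mpr (neg_le_neg h2)
      _ = δ / 2 := by rw [Real.exp_neg, Real.exp_log (by positivity), inv_div]
  have hU : μ.real {x | a ≤ (missCount x : ℝ) - N * p} ≤ δ / 2 :=
    (measureReal_ge_le_of_subgaussian μ hN0 ha0 (subgaussian_missCount A θ p)).trans hexp
  have hL : μ.real {x | a ≤ -((missCount x : ℝ) - N * p)} ≤ δ / 2 := by
    refine (measureReal_ge_le_of_subgaussian μ hN0 ha0 fun s => ?_).trans hexp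
    have := subgaussian_missCount (m := m) A θ p (-s)
    simpa only [neg_mul, mul_neg, neg_sq] using this
  have hcompl : {x : Fin m → Obs n | |pHat x - (p : ℝ)| ≤ δ / √((T : ℝ) * n)}ᶜ ⊆
      {x | a ≤ (missCount x : ℝ) - N * p} ∪ {x | a ≤ -((missCount x : ℝ) - N * p)} := by
    intro x hx
    simp only [Set.mem_compl_iff, Set.mem_ofPred_eq, not_le] at hx
    have h1 : N * (pHat x - p) = missCount x - N * p := by
      rw [pHat_eq, hNe]
      field_simp
    have h2 : a < |(missCount x : ℝ) - N * p| := by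
      rw [← h1, abs_mul, abs_of_pos hN0]
      exact mul_lt_mul_of_pos_left hx hN0
    rcases lt_abs.mp h2 with h | h
    · exact Or.inl h.le
    · exact Or.inr h.le
  have h1 := (measureReal_mono (μ := μ) hcompl).trans (measureReal_union_le _ _)
  rw [probReal_compl_eq_one_sub .of_discrete] at h1
  linarith

/-! ### Multiplicative updates -/

/-- Use `exp (x + 2 * x ^ 2) ≥ 1 + x + 2 * x ^ 2` and `(1 - x) * (1 + x + 2 * x ^ 2) = 1 + x ^ 2 *
(1 - 2 * x)`. -/
lemma exp_neg_sub_le {x : ℝ} (hx : |x| ≤ 1 / 4) : Real.exp (-x - 2 * x ^ 2) ≤ 1 - x := by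
  obtain ⟨h1, h2⟩ := abs_le.mp hx
  have h3 := Real.add_one_le_exp (x + 2 * x ^ 2)
  have h4 : Real.exp (-x - 2 * x ^ 2) * Real.exp (x + 2 * x ^ 2) = 1 := by
    rw [← Real.exp_add]
    ring_nf
    exact Real.exp_zero
  have h5 : 1 ≤ (1 - x) * Real.exp (x + 2 * x ^ 2) := by
    have h6 := mul_le_mul_of_nonneg_left h3 (show 0 ≤ 1 - x by linarith)
    have h7 : 0 ≤ x ^ 2 * (1 - 2 * x) := mul_nonneg (sq_nonneg x) (by linarith)
    nlinarith
  exact le_of_mul_le_mul_right (h4.le.trans h5) (Real.exp_pos _)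

/-- The scaled simplex: nonnegative vectors whose coordinates sum to `lam`. -/
def scaledSimplex (κ : Type*) [Fintype κ] (lam : ℝ) : Set (κ → ℝ) :=
  {w | (∀ k, 0 ≤ w k) ∧ ∑ k, w k = lam}

section Multiplicative

variable {κ : Type*} [Fintype κ] {lam η B : ℝ}

lemma abs_sum_mul_div_le {w G : κ → ℝ} (hlam : 0 < lam) (hw : w ∈ scaledSimplex κ lam)
    (hG : ∀ k, |G k| ≤ B) : |(∑ k, w k * G k) / lam| ≤ B := by
  rw [abs_div, abs_of_pos hlam, div_le_iff₀ hlam]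
  refine (Finset.abs_sum_le_sum_abs _ _).trans ?_
  rw [← hw.2, Finset.mul_sum]
  refine Finset.sum_le_sum fun k _ => ?_
  rw [abs_mul, abs_of_nonneg (hw.1 k), mul_comm]
  exact mul_le_mul_of_nonneg_right (hG k) (hw.1 k)

lemma abs_eta_mul_le {w G : κ → ℝ} (hlam : 0 < lam) (hη : 0 ≤ η) (hηB : η * B ≤ 1 / 8)
    (hw : w ∈ scaledSimplex κ lam) (hG : ∀ k, |G k| ≤ B) (k : κ) :
    |η * (G k - (∑ k, w k * G k) / lam)| ≤ 2 * (η * B) ∧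
      |η * (G k - (∑ k, w k * G k) / lam)| ≤ 1 / 4 := by
  have h : |η * (G k - (∑ k, w k * G k) / lam)| ≤ 2 * (η * B) := by
    rw [abs_mul, abs_of_nonneg hη]
    have := (abs_sub (G k) ((∑ k, w k * G k) / lam)).trans
      (add_le_add (hG k) (abs_sum_mul_div_le hlam hw hG))
    nlinarith
  exact ⟨h, by linarith⟩

/-- The centring term is the `w`-average of `G`, which is exactly what preserves the total mass; no
renormalisation is needed. Positivity holds because the relative change is at most `1 / 4`. -/
lemma mul_update_mem_scaledSimplex {w G : κ → ℝ} (hlam : 0 < lam) (hη : 0 ≤ η)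
    (hηB : η * B ≤ 1 / 8) (hw : w ∈ scaledSimplex κ lam) (hG : ∀ k, |G k| ≤ B) :
    (fun k => w k * (1 - η * G k + η * ((∑ k, w k * G k) / lam))) ∈ scaledSimplex κ lam := by
  constructor
  · intro k
    have := (abs_le.mp (abs_eta_mul_le hlam hη hηB hw hG k).2).2
    exact mul_nonneg (hw.1 k) (by nlinarith)
  · have h : ∀ k, w k * (1 - η * G k + η * ((∑ k, w k * G k) / lam)) =
        w k - η * (w k * G k) + w k * (η * ((∑ k, w k * G k) / lam)) := fun k => by ring
    simp_rw [h]
    rw [Finset.sum_add_distrib, Finset.sum_sub_distrib, ← Finset.mul_sum, ← Finset.sum_mul, hw.2]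
    field_simp
    ring

/-- The regret bound for multiplicative updates. -/
lemma mul_update_regret {w G : ℕ → κ → ℝ} (hlam : 0 < lam) (hη : 0 < η) (hηB : η * B ≤ 1 / 8)
    (hκ : 0 < Fintype.card κ) (hG : ∀ t k, |G t k| ≤ B)
    (h0 : ∀ k, w 0 k = lam / Fintype.card κ) (hmem : ∀ t, w t ∈ scaledSimplex κ lam)
    (hw : ∀ t k, w (t + 1) k =
      w t k * (1 - η * G t k + η * ((∑ k, w t k * G t k) / lam)))
    {u : κ → ℝ} (hu : u ∈ scaledSimplex κ lam) (T : ℕ) :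
    ∑ t ∈ Finset.range T, ∑ k, (w t k - u k) * G t k ≤
      lam * (Real.log (Fintype.card κ) / η + 8 * η * T * B ^ 2) := by
  set N : ℝ := (Fintype.card κ : ℝ) with hN
  have hN0 : 0 < N := by rw [hN]; exact_mod_cast hκ
  set C : ℕ → ℝ := fun t => (∑ k, w t k * G t k) / lam with hC
  have hr := fun t k => abs_eta_mul_le hlam hη.le hηB (hmem t) (hG t) k
  have hB : 0 ≤ B := by
    obtain ⟨k⟩ := Fintype.card_pos_iff.mp hκ
    exact (abs_nonneg _).trans (hG 0 k)
  -- Each coordinate grows at least exponentially in the advantage of `k` over the current average,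
  -- up to a second-order loss `2 * (2 * η * B) ^ 2` per step. Since no coordinate exceeds `lam`,
  -- that advantage is bounded.
  have h1 : ∀ k (t : ℕ), lam / N * Real.exp (η * (∑ s ∈ Finset.range t, (C s - G s k)) -
      t * (8 * (η * B) ^ 2)) ≤ w t k := by
    intro k t
    induction t with
    | zero => simp [h0]
    | succ t ih =>
      rw [hw t k, Finset.sum_range_succ]
      have h2 := exp_neg_sub_le (hr t k).2
      have h3 : (η * (G t k - C t)) ^ 2 ≤ (2 * (η * B)) ^ 2 :=
        sq_le_sq' (by linarith [(abs_le.mp (hr t k).1).1]) (abs_le.mp (hr t k).1).2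
      have h4 : Real.exp (η * (C t - G t k) - 8 * (η * B) ^ 2) ≤
          1 - η * G t k + η * C t := by
        refine (Real.exp_le_exp.mpr ?_).trans (h2.trans (le_of_eq ?_))
        · change _ ≤ -(η * (G t k - C t)) - 2 * (η * (G t k - C t)) ^ 2
          linarith
        · change 1 - η * (G t k - C t) = _
          ring
      refine le_trans (le_of_eq ?_) (mul_le_mul ih h4 (Real.exp_pos _).le ((hmem t).1 k))
      rw [mul_assoc, ← Real.exp_add]
      congr 2
      push_cast
      ring
  have h2 : ∀ k, ∑ t ∈ Finset.range T, (C t - G t k) ≤ Real.log N / η + 8 * η * T * B ^ 2 := by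
    intro k
    have h3 : w T k ≤ lam := by
      rw [← (hmem T).2]
      exact Finset.single_le_sum (fun k _ => (hmem T).1 k) (Finset.mem_univ k)
    have h4 := (h1 k T).trans h3
    have h5 : Real.exp (η * (∑ s ∈ Finset.range T, (C s - G s k)) - T * (8 * (η * B) ^ 2)) ≤ N := by
      rw [div_mul_eq_mul_div, div_le_iff₀ hN0] at h4
      exact le_of_mul_le_mul_left h4 hlam
    have h6 := Real.log_le_log (Real.exp_pos _) h5
    rw [Real.log_exp] at h6
    have h7 : Real.log N / η + 8 * η * T * B ^ 2 =
        (Real.log N + T * (8 * (η * B) ^ 2)) / η := by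
      field_simp
    rw [h7, le_div_iff₀ hη]
    linarith
  -- As `u` has mass `lam`, the regret against `u` is a `u`-weighted sum of the advantages just
  -- bounded.
  have h3 : ∀ t, ∑ k, (w t k - u k) * G t k = ∑ k, u k * (C t - G t k) := fun t => by
    have h4 : ∑ k, w t k * G t k = lam * C t := by
      rw [hC]; field_simp
    simp_rw [sub_mul, mul_sub, Finset.sum_sub_distrib, ← Finset.sum_mul, hu.2, h4]
  simp_rw [h3]
  rw [Finset.sum_comm]
  simp_rw [← Finset.mul_sum]
  rw [← hu.2, Finset.sum_mul]
  exact Finset.sum_le_sum fun k _ => mul_le_mul_of_nonneg_left (h2 k) (hu.1 k)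

end Multiplicative

/-! ### The gradient estimator -/

lemma Entry.abs_toReal_le (e : Entry) : |e.toReal| ≤ 1 := by
  rcases e with _ | s
  · simp [Entry.toReal]
  · rcases Int.units_eq_one_or s with rfl | rfl <;> simp [Entry.toReal]

lemma sum_coord {n : ℕ} {v : Fin n} (f : Coord v → ℝ) :
    ∑ k, f k = ∑ i, f (.inl (.inl i)) + ∑ i, f (.inl (.inr i)) + f (.inr ()) := by
  rw [Fintype.sum_sum_type, Fintype.sum_sum_type]
  simp

lemma card_coord {n : ℕ} (v : Fin n) : (Fintype.card (Coord v) : ℝ) = 2 * (n : ℝ) - 1 := by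
  have hn : 1 ≤ n := v.pos
  have h : Fintype.card {j : Fin n // j ≠ v} = n - 1 := by
    simp [Fintype.card_subtype_compl]
  rw [Fintype.card_sum, Fintype.card_sum, h]
  push_cast [Nat.cast_sub hn]
  simp
  ring

lemma sum_abs_toBall_le {n : ℕ} {v : Fin n} {lam : ℝ} {w : Coord v → ℝ}
    (hw : w ∈ scaledSimplex (Coord v) lam) : ∑ i, |toBall w i| ≤ lam := by
  rw [← hw.2, sum_coord, ← Finset.sum_add_distrib]
  have : ∑ i, |toBall w i| ≤ ∑ i, (w (.inl (.inl i)) + w (.inl (.inr i))) := by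
    refine Finset.sum_le_sum fun i _ => ?_
    have h1 := hw.1 (.inl (.inl i))
    have h2 := hw.1 (.inl (.inr i))
    exact abs_le.mpr ⟨by unfold toBall; linarith, by unfold toBall; linarith⟩
  linarith [hw.1 (.inr ())]

/-- For the upper bound, convexity of `exp` gives `exp a ≤ q + (1 - q) * exp (a / (1 - q))`. An
exponential bound per factor lets the product over neighbours be controlled by the `ℓ₁` norm alone.
-/
lemma abs_exp_sub_div_le {q a y : ℝ} (hq0 : 0 ≤ q) (hq1 : q < 1) (hy : |y| ≤ a) :
    |(Real.exp (-y) - q) / (1 - q)| ≤ Real.exp (a / (1 - q)) := by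
  have hq : 0 < 1 - q := by linarith
  obtain ⟨h1, h2⟩ := abs_le.mp hy
  have ha : 0 ≤ a := (abs_nonneg y).trans hy
  refine abs_le.mpr ⟨?_, ?_⟩
  · rw [le_div_iff₀ hq]
    have h3 := Real.add_one_le_exp (-y)
    have h4 := Real.add_one_le_exp (a / (1 - q))
    have h5 : a / (1 - q) * (1 - q) = a := by field_simp
    nlinarith
  · rw [div_le_iff₀ hq]
    have h3 := convexOn_exp.2 (Set.mem_univ 0) (Set.mem_univ (a / (1 - q))) hq0 hq.le (by ring)
    have h5 : (1 - q) * (a / (1 - q)) = a := by field_simp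
    simp only [smul_eq_mul, mul_zero, zero_add, Real.exp_zero, mul_one, h5] at h3
    have h4 : Real.exp (-y) ≤ Real.exp a := Real.exp_le_exp.mpr (by linarith)
    linarith

lemma gradBound_nonneg (lam p : ℝ) : 0 ≤ gradBound lam p := by
  unfold gradBound; positivity

lemma abs_gMiss_le {n : ℕ} {v : Fin n} {lam q : ℝ} (hq0 : 0 ≤ q) (hq1 : q ≤ 1) {w : Coord v → ℝ}
    (hw : w ∈ scaledSimplex (Coord v) lam) (X : Obs n) (i : {j : Fin n // j ≠ v}) :
    |gMiss q v w X i| ≤ gradBound lam q := by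
  -- At `q = 1` division by zero makes both sides `0`. The estimate can take this value, when every
  -- entry is missing.
  rcases hq1.eq_or_lt with rfl | hq1
  · simp [gMiss, gradBound]
  have hq : 0 < 1 - q := by linarith
  have hy : ∀ j : {j : Fin n // j ≠ v},
      |toBall w j * (X v).toReal * (X j).toReal| ≤ |toBall w j| := fun j => by
    rw [abs_mul, abs_mul, mul_assoc]
    exact mul_le_of_le_one_right (abs_nonneg _)
      (mul_le_one₀ (Entry.abs_toReal_le _) (abs_nonneg _) (Entry.abs_toReal_le _))
  have h1 : |-((X v).toReal / (1 - q))| ≤ 1 / (1 - q) := by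
    rw [abs_neg, abs_div, abs_of_pos hq]
    gcongr
    exact Entry.abs_toReal_le _
  have h2 : |Real.exp (-(toBall w i * (X v).toReal * (X i).toReal)) * (X i).toReal / (1 - q)| ≤
      Real.exp (|toBall w i| / (1 - q)) / (1 - q) := by
    rw [abs_div, abs_of_pos hq, abs_mul, Real.abs_exp]
    gcongr
    refine (mul_le_of_le_one_right (Real.exp_pos _).le (Entry.abs_toReal_le _)).trans
      (Real.exp_le_exp.mpr ?_)
    have h3 := (neg_le_abs _).trans (hy i)
    refine h3.trans ?_
    rw [le_div_iff₀ hq]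
    nlinarith [abs_nonneg (toBall w i)]
  have h3 : |∏ j ∈ Finset.univ.erase i,
      (Real.exp (-(toBall w j * (X v).toReal * (X j).toReal)) - q) / (1 - q)| ≤
      ∏ j ∈ Finset.univ.erase i, Real.exp (|toBall w j| / (1 - q)) := by
    rw [Finset.abs_prod]
    exact Finset.prod_le_prod (fun _ _ => abs_nonneg _) fun j _ =>
      abs_exp_sub_div_le hq0 hq1 (hy j)
  have h4 : Real.exp (|toBall w i| / (1 - q)) *
      ∏ j ∈ Finset.univ.erase i, Real.exp (|toBall w j| / (1 - q)) ≤ Real.exp (lam / (1 - q)) := by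
    rw [Finset.mul_prod_erase _ (fun j => Real.exp (|toBall w j| / (1 - q))) (Finset.mem_univ i),
      ← Real.exp_sum, ← Finset.sum_div]
    refine Real.exp_le_exp.mpr ?_
    gcongr
    exact sum_abs_toBall_le hw
  unfold gMiss
  rw [abs_mul, abs_mul]
  calc _ ≤ 1 / (1 - q) * (Real.exp (|toBall w i| / (1 - q)) / (1 - q)) *
        ∏ j ∈ Finset.univ.erase i, Real.exp (|toBall w j| / (1 - q)) := by gcongr
    _ = (Real.exp (|toBall w i| / (1 - q)) *
        ∏ j ∈ Finset.univ.erase i, Real.exp (|toBall w j| / (1 - q))) / (1 - q) ^ 2 := by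
      field_simp
    _ ≤ gradBound lam q := by
      unfold gradBound
      gcongr

lemma abs_gradMiss_le {n : ℕ} {v : Fin n} {lam q : ℝ} (hq0 : 0 ≤ q) (hq1 : q ≤ 1)
    {w : Coord v → ℝ} (hw : w ∈ scaledSimplex (Coord v) lam) (X : Obs n) (k : Coord v) :
    |gradMiss q v w X k| ≤ gradBound lam q := by
  rcases k with (i | i) | _
  · exact abs_gMiss_le hq0 hq1 hw X i
  · simpa [gradMiss] using abs_gMiss_le hq0 hq1 hw X i
  · simpa [gradMiss] using gradBound_nonneg lam q

lemma sum_mul_gradMiss {n : ℕ} {v : Fin n} (q : ℝ) (u w : Coord v → ℝ) (X : Obs n) :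
    ∑ k, u k * gradMiss q v w X k = ∑ i, toBall u i * gMiss q v w X i := by
  rw [sum_coord]
  simp only [gradMiss, mul_neg, mul_zero, add_zero, Finset.sum_neg_distrib, toBall, sub_mul,
    Finset.sum_sub_distrib]
  ring

/-! ### The iterates -/

lemma smgIter_mem {n T : ℕ} {v : Fin n} {lam q η : ℝ} (hlam : 0 < lam) (hq0 : 0 ≤ q) (hq1 : q ≤ 1)
    (hη : 0 ≤ η) (hηB : η * gradBound lam q ≤ 1 / 8) (x : Fin T → Obs n) (t : ℕ) :
    smgIter lam q η v x t ∈ scaledSimplex (Coord v) lam := by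
  have hn : (1 : ℝ) ≤ n := by exact_mod_cast v.pos
  have hN : (0 : ℝ) < 2 * (n : ℝ) - 1 := by linarith
  induction t with
  | zero =>
    refine ⟨fun k => div_nonneg hlam.le hN.le, ?_⟩
    simp only [smgIter, Finset.sum_const, Finset.card_univ, nsmul_eq_mul, card_coord]
    field_simp
  | succ t ih =>
    rw [smgIter]
    split_ifs with h
    · exact mul_update_mem_scaledSimplex hlam hη hηB ih (abs_gradMiss_le hq0 hq1 ih _)
    · exact ih

/-- Positive and negative parts, with the slack coordinate taking the unused `ℓ₁` mass. -/
lemma exists_simplex_toBall {n : ℕ} {v : Fin n} {lam : ℝ} (a : {j : Fin n // j ≠ v} → ℝ)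
    (ha : ∑ i, |a i| ≤ lam) :
    ∃ u ∈ scaledSimplex (Coord v) lam, ∀ i, toBall u i = a i := by
  refine ⟨fun k => match k with
    | .inl (.inl i) => max (a i) 0
    | .inl (.inr i) => max (-a i) 0
    | .inr _ => lam - ∑ i, |a i|, ⟨?_, ?_⟩, ?_⟩
  · rintro ((i | i) | _)
    · exact le_max_right _ _
    · exact le_max_right _ _
    · exact sub_nonneg.mpr ha
  · rw [sum_coord]
    have h : ∀ i, |a i| = max (a i) 0 + max (-a i) 0 := fun i => by
      rcases le_total 0 (a i) with h | h
      · rw [abs_of_nonneg h, max_eq_left h, max_eq_right (by linarith), add_zero]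
      · rw [abs_of_nonpos h, max_eq_right h, max_eq_left (by linarith), zero_add]
    simp only [h, Finset.sum_add_distrib]
    ring
  · intro i
    simp only [toBall]
    rcases le_total 0 (a i) with h | h
    · rw [max_eq_left h, max_eq_right (by linarith), sub_zero]
    · rw [max_eq_right h, max_eq_left (by linarith)]; ring

lemma smg_regret {n T : ℕ} {v : Fin n} {lam q η : ℝ} (hlam : 0 < lam) (hq0 : 0 ≤ q) (hq1 : q ≤ 1)
    (hη : 0 < η) (hηB : η * gradBound lam q ≤ 1 / 8) (x : Fin T → Obs n)
    (a : {j : Fin n // j ≠ v} → ℝ) (ha : ∑ i, |a i| ≤ lam) :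
    ∑ t : Fin T, ∑ i, (toBall (smgIter lam q η v x t) i - a i) *
        gMiss q v (smgIter lam q η v x t) (x t) i ≤
      lam * (Real.log (2 * (n : ℝ) - 1) / η + 8 * η * T * gradBound lam q ^ 2) := by
  obtain ⟨u, hu, hua⟩ := exists_simplex_toBall a ha
  set w := smgIter lam q η v x
  have hmem : ∀ t, w t ∈ scaledSimplex (Coord v) lam := smgIter_mem hlam hq0 hq1 hη.le hηB x
  -- The regret bound wants gradients at all times; zero gradients after `T` match the iterates,
  -- which freeze there.
  set G : ℕ → Coord v → ℝ := fun t =>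
    if h : t < T then gradMiss q v (w t) (x ⟨t, h⟩) else 0 with hGdef
  have hG : ∀ t k, |G t k| ≤ gradBound lam q := fun t k => by
    simp only [hGdef]
    split_ifs
    · exact abs_gradMiss_le hq0 hq1 (hmem t) _ k
    · simpa using gradBound_nonneg lam q
  have hstep : ∀ t k, w (t + 1) k =
      w t k * (1 - η * G t k + η * ((∑ k, w t k * G t k) / lam)) := fun t k => by
    by_cases h : t < T
    · simp only [hGdef, h, dif_pos, w]
      rw [smgIter, dif_pos h, smgStep]
    · simp only [hGdef, h, w]
      rw [smgIter, dif_neg h]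
      simp
  have h := mul_update_regret hlam hη hηB (Fintype.card_pos_iff.mpr ⟨.inr ()⟩) hG
    (fun k => by rw [card_coord]; rfl) hmem hstep hu T
  rw [card_coord, Finset.sum_range] at h
  refine le_trans (le_of_eq ?_) h
  refine Finset.sum_congr rfl fun t _ => ?_
  simp only [hGdef, t.2, dif_pos, Fin.eta, sub_mul, Finset.sum_sub_distrib, sum_mul_gradMiss, hua]

/-! ### Martingale concentration along the iterates -/

/-- Predictability: the iterate at time `t` does not see the samples from `t` on. -/
lemma smgIter_snoc {n T : ℕ} {v : Fin n} (lam q η : ℝ) (x : Fin T → Obs n) (X : Obs n) {t : ℕ}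
    (ht : t ≤ T) :
    smgIter lam q η v (Fin.snoc x X : Fin (T + 1) → Obs n) t = smgIter lam q η v x t := by
  induction t with
  | zero => rfl
  | succ t ih =>
    have h1 : t < T := ht
    rw [smgIter, smgIter, dif_pos (h1.trans (Nat.lt_succ_self T)), dif_pos h1, ih h1.le]
    congr 1
    exact Fin.snoc_castSucc (α := fun _ => Obs n) X x ⟨t, h1⟩

/-- Azuma–Hoeffding by induction on `T`: with the first `T` samples fixed the last iterate is fixed,
so summing over the last sample is Hoeffding's lemma for one centred increment. -/
lemma sum_exp_martingale_le {n : ℕ} {v : Fin n} {lam q η c : ℝ} {P : Obs n → ℝ}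
    (hP : ∀ X, 0 ≤ P X) (hP1 : ∑ X, P X = 1) (hc : 0 < c)
    {D : (Coord v → ℝ) → Obs n → ℝ} {S : Set (Coord v → ℝ)}
    (hS : ∀ {T : ℕ} (x : Fin T → Obs n) t, smgIter lam q η v x t ∈ S)
    (hD : ∀ w ∈ S, ∀ X, |D w X| ≤ c) (h0 : ∀ w ∈ S, ∑ X, P X * D w X = 0) (s : ℝ) (T : ℕ) :
    ∑ x : Fin T → Obs n, (∏ t, P (x t)) *
        Real.exp (s * ∑ t : Fin T, D (smgIter lam q η v x t) (x t)) ≤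
      Real.exp (s ^ 2 * (T * c ^ 2) / 2) := by
  induction T with
  | zero => simp
  | succ T ih =>
    rw [← Equiv.sum_comp (Fin.snocEquiv fun _ : Fin (T + 1) => Obs n), Fintype.sum_prod_type_right]
    have h1 : ∀ (x : Fin T → Obs n) (X : Obs n),
        (∏ t, P ((Fin.snocEquiv fun _ : Fin (T + 1) => Obs n) (X, x) t)) *
          Real.exp (s * ∑ t : Fin (T + 1),
            D (smgIter lam q η v ((Fin.snocEquiv fun _ : Fin (T + 1) => Obs n) (X, x)) t)
              ((Fin.snocEquiv fun _ : Fin (T + 1) => Obs n) (X, x) t)) =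
        ((∏ t, P (x t)) * Real.exp (s * ∑ t : Fin T, D (smgIter lam q η v x t) (x t))) *
          (P X * Real.exp (s * D (smgIter lam q η v x T) X)) := by
      intro x X
      have e : (Fin.snocEquiv fun _ : Fin (T + 1) => Obs n) (X, x) = Fin.snoc x X := rfl
      rw [e, Fin.prod_univ_castSucc, Fin.sum_univ_castSucc]
      simp only [Fin.snoc_castSucc, Fin.snoc_last, Fin.val_castSucc, Fin.val_last,
        smgIter_snoc lam q η x X le_rfl]
      have h2 : ∀ t : Fin T, smgIter lam q η v (Fin.snoc x X : Fin (T + 1) → Obs n) t =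
          smgIter lam q η v x t := fun t => smgIter_snoc lam q η x X t.2.le
      simp only [h2, mul_add, Real.exp_add]
      ring
    simp_rw [h1, ← Finset.mul_sum]
    have h3 : ∀ x : Fin T → Obs n, ∑ X, P X * Real.exp (s * D (smgIter lam q η v x T) X) ≤
        Real.exp (s ^ 2 * c ^ 2 / 2) := fun x =>
      sum_mul_exp_le s hc hP hP1 (hD _ (hS x T)) (h0 _ (hS x T))
    refine (Finset.sum_le_sum fun x _ => mul_le_mul_of_nonneg_left (h3 x)
      (mul_nonneg (Finset.prod_nonneg fun _ _ => hP _) (Real.exp_pos _).le)).trans ?_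
    rw [← Finset.sum_mul]
    refine (mul_le_mul_of_nonneg_right ih (Real.exp_pos _).le).trans (le_of_eq ?_)
    rw [← Real.exp_add]
    congr 1
    push_cast
    ring

/-- The mean of the gradient estimator. -/
def meanGrad {n : ℕ} (A : Matrix (Fin n) (Fin n) ℝ) (q : I) (v : Fin n) (w : Coord v → ℝ)
    (i : {j : Fin n // j ≠ v}) : ℝ :=
  ∑ X, (missLaw A 0 q).real {X} * gMiss q v w X i

lemma abs_meanGrad_le {n : ℕ} (A : Matrix (Fin n) (Fin n) ℝ) (q : I) {v : Fin n} {lam : ℝ}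
    {w : Coord v → ℝ} (hw : w ∈ scaledSimplex (Coord v) lam) (i : {j : Fin n // j ≠ v}) :
    |meanGrad A q v w i| ≤ gradBound lam q := by
  refine (Finset.abs_sum_le_sum_abs _ _).trans ?_
  have h : ∀ X, |(missLaw A 0 q).real {X} * gMiss q v w X i| ≤
      (missLaw A 0 q).real {X} * gradBound lam q := fun X => by
    rw [abs_mul, abs_of_nonneg measureReal_nonneg]
    exact mul_le_mul_of_nonneg_left (abs_gMiss_le q.2.1 q.2.2 hw X i) measureReal_nonneg
  refine (Finset.sum_le_sum fun X _ => h X).trans ?_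
  rw [← Finset.sum_mul, sum_measureReal_univ, one_mul]

/-- With high probability the sampled gradients are as good as their means. -/
lemma measureReal_martingale_ge_le {n T : ℕ} {v : Fin n} {lam η : ℝ} (hlam : 0 < lam) (hT : 1 ≤ T)
    (A : Matrix (Fin n) (Fin n) ℝ) (q : I) (hq : (q : ℝ) < 1) (hη : 0 ≤ η)
    (hηB : η * gradBound lam q ≤ 1 / 8)
    (a : {j : Fin n // j ≠ v} → ℝ) (ha : ∑ i, |a i| ≤ lam) {L : ℝ} (hL : 0 ≤ L) :
    (samplesLaw A 0 q T).real {x | 4 * lam * gradBound lam q * √(2 * T * L) ≤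
        ∑ t : Fin T, ∑ i, (toBall (smgIter lam q η v x t) i - a i) *
          (meanGrad A q v (smgIter lam q η v x t) i -
            gMiss q v (smgIter lam q η v x t) (x t) i)} ≤ Real.exp (-L) := by
  set B := gradBound lam q with hB
  have hB0 : 0 < B := div_pos (Real.exp_pos _) (pow_pos (by linarith) 2)
  -- Bound on an increment: `ℓ₁` distance at most `2 * lam` to the comparison point, times `2 * B`
  -- for the centred gradient.
  set c : ℝ := 4 * lam * B with hc
  have hc0 : 0 < c := by positivity
  have hT0 : (0 : ℝ) < T := by positivity
  have h1 := measureReal_ge_le_of_subgaussian (samplesLaw A 0 q T)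
    (Y := fun x => ∑ t : Fin T, ∑ i, (toBall (smgIter lam q η v x t) i - a i) *
          (meanGrad A q v (smgIter lam q η v x t) i -
            gMiss q v (smgIter lam q η v x t) (x t) i))
    (V := T * c ^ 2) (a := c * √(2 * T * L)) (by positivity) (by positivity) (fun s => by
      have hs : ∀ x, (samplesLaw A 0 q T).real {x} = ∏ t, (missLaw A 0 q).real {x t} := fun x => by
        rw [samplesLaw, measureReal_pi_singleton]
      simp_rw [hs]
      refine sum_exp_martingale_le (P := fun X => (missLaw A 0 q).real {X})
        (D := fun w X => ∑ i, (toBall w i - a i) * (meanGrad A q v w i - gMiss q v w X i))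
        (S := scaledSimplex (Coord v) lam) (fun _ => measureReal_nonneg)
        (sum_measureReal_univ _) hc0 (fun x t => smgIter_mem hlam q.2.1 hq.le hη hηB x t)
        ?_ ?_ s T
      · intro w hw X
        have h2 : ∀ i, |(toBall w i - a i) * (meanGrad A q v w i - gMiss q v w X i)| ≤
            (|toBall w i| + |a i|) * (2 * B) := fun i => by
          rw [abs_mul]
          refine mul_le_mul (abs_sub _ _) ?_ (abs_nonneg _) (by positivity)
          refine (abs_sub _ _).trans ?_
          linarith [abs_meanGrad_le A q hw i, abs_gMiss_le q.2.1 hq.le hw X i]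
        refine (Finset.abs_sum_le_sum_abs _ _).trans ((Finset.sum_le_sum fun i _ => h2 i).trans ?_)
        rw [← Finset.sum_mul, Finset.sum_add_distrib, hc]
        nlinarith [sum_abs_toBall_le hw]
      · intro w hw
        simp_rw [Finset.mul_sum]
        rw [Finset.sum_comm]
        refine Finset.sum_eq_zero fun i _ => ?_
        have h3 : ∀ X, (missLaw A 0 q).real {X} *
            ((toBall w i - a i) * (meanGrad A q v w i - gMiss q v w X i)) =
            (toBall w i - a i) * ((missLaw A 0 q).real {X} * meanGrad A q v w i -
              (missLaw A 0 q).real {X} * gMiss q v w X i) := fun X => by ring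
        simp_rw [h3, ← Finset.mul_sum, Finset.sum_sub_distrib, ← Finset.sum_mul,
          sum_measureReal_univ]
        simp [meanGrad])
  refine h1.trans (Real.exp_le_exp.mpr (le_of_eq ?_))
  rw [mul_pow, Real.sq_sqrt (by positivity)]
  field_simp

/-! ### Flipping a spin -/

/-- The real value of a spin. -/
def spin {n : ℕ} (z : Config n) (i : Fin n) : ℝ := ((z i : ℤ) : ℝ)

lemma spin_mul_self {n : ℕ} (z : Config n) (i : Fin n) : spin z i * spin z i = 1 := by
  unfold spin
  exact_mod_cast Int.units_coe_mul_self (z i)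

lemma abs_spin {n : ℕ} (z : Config n) (i : Fin n) : |spin z i| = 1 := by
  unfold spin
  rcases Int.units_eq_one_or (z i) with h | h <;> simp [h]

/-- Flip the spin at `v`. -/
def flip {n : ℕ} (v : Fin n) : Equiv.Perm (Config n) :=
  Function.Involutive.toPerm (fun z => Function.update z v (-z v)) fun z => by
    simp

lemma spin_flip {n : ℕ} (v : Fin n) (z : Config n) (i : Fin n) :
    spin (flip v z) i = spin z i - if i = v then 2 * spin z v else 0 := by
  change ((Function.update z v (-z v) i : ℤ) : ℝ) = _
  by_cases h : i = v
  · subst h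
    simp [spin]
    ring
  · simp [h, spin]

lemma spin_flip_self {n : ℕ} (v : Fin n) (z : Config n) : spin (flip v z) v = -spin z v := by
  rw [spin_flip, if_pos rfl]; ring

lemma spin_flip_of_ne {n : ℕ} {v i : Fin n} (h : i ≠ v) (z : Config n) :
    spin (flip v z) i = spin z i := by
  rw [spin_flip, if_neg h, sub_zero]

lemma sum_sum_Ioi {n : ℕ} (f : Fin n → Fin n → ℝ) (hs : ∀ i j, f i j = f j i)
    (h0 : ∀ i, f i i = 0) :
    ∑ i, ∑ j, f i j = 2 * ∑ i, ∑ j ∈ Finset.Ioi i, f i j := by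
  have h1 : ∀ i, ∑ j, f i j = ∑ j ∈ Finset.Iio i, f i j + ∑ j ∈ Finset.Ioi i, f i j := by
    intro i
    rw [← Finset.sum_erase_add _ _ (Finset.mem_univ i), h0, add_zero, ← Finset.sum_union]
    · refine Finset.sum_congr ?_ fun _ _ => rfl
      ext j
      simp
    · refine Finset.disjoint_left.mpr fun j h1 h2 => ?_
      simp only [Finset.mem_Iio, Finset.mem_Ioi] at h1 h2
      exact absurd h1 h2.not_gt
  simp_rw [h1, Finset.sum_add_distrib]
  have h2 : ∑ i, ∑ j ∈ Finset.Iio i, f i j = ∑ i, ∑ j ∈ Finset.Ioi i, f i j := by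
    rw [Finset.sum_comm' (t' := Finset.univ) (s' := fun j => Finset.Ioi j) (by simp)]
    exact Finset.sum_congr rfl fun i _ => Finset.sum_congr rfl fun j _ => hs _ _
  rw [h2]
  ring

/-- The full double sum treats both indices alike, so the effect of a flip can be read off without
ordering them. -/
lemma two_mul_energy {n : ℕ} {A : Matrix (Fin n) (Fin n) ℝ} (hA : A.IsSymm)
    (h0 : ∀ i, A i i = 0) (z : Config n) :
    2 * energy A 0 z = ∑ i, ∑ j, A i j * spin z i * spin z j := by
  rw [sum_sum_Ioi _ (fun i j => by rw [← hA.apply i j]; ring) (fun i => by simp [h0])]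
  simp [energy, spin]

lemma energy_flip {n : ℕ} {A : Matrix (Fin n) (Fin n) ℝ} (hA : A.IsSymm)
    (h0 : ∀ i, A i i = 0) (z : Config n) (v : Fin n) :
    energy A 0 (flip v z) = energy A 0 z - 2 * ∑ j, A v j * spin z v * spin z j := by
  have h1 := two_mul_energy hA h0 z
  have h2 := two_mul_energy hA h0 (flip v z)
  have h3 : ∑ i, ∑ j, A i j * spin (flip v z) i * spin (flip v z) j =
      ∑ i, ∑ j, A i j * spin z i * spin z j - 4 * ∑ j, A v j * spin z v * spin z j := by
    have e : ∀ i j, A i j * spin (flip v z) i * spin (flip v z) j =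
        A i j * spin z i * spin z j -
          (if j = v then A v i * spin z i * (2 * spin z v) else 0) -
          (if i = v then A v j * (2 * spin z v) * spin z j else 0) := by
      intro i j
      rw [spin_flip, spin_flip]
      split_ifs with hi hj hj
      · subst hi; subst hj; rw [h0]; ring
      · subst hi; ring
      · subst hj; rw [hA.apply i j]; ring
      · ring
    simp_rw [e, Finset.sum_sub_distrib, Finset.sum_ite_eq' Finset.univ v,
      Finset.mem_univ, if_true]
    rw [Finset.sum_comm (f := fun i j => if i = v then A v j * (2 * spin z v) * spin z j else 0)]
    simp_rw [Finset.sum_ite_eq' Finset.univ v, Finset.mem_univ, if_true]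
    rw [sub_sub, ← Finset.sum_add_distrib, Finset.mul_sum]
    congr 1
    exact Finset.sum_congr rfl fun j _ => by ring
  linarith

lemma spinWeight_flip {n : ℕ} {A : Matrix (Fin n) (Fin n) ℝ} (hA : A.IsSymm)
    (h0 : ∀ i, A i i = 0) (z : Config n) (v : Fin n) :
    spinWeight A 0 (flip v z) =
      spinWeight A 0 z * Real.exp (-(2 * ∑ j, A v j * spin z v * spin z j)) := by
  unfold spinWeight
  rw [energy_flip hA h0, sub_eq_add_neg, Real.exp_add]
  ring

/-! ### The mean gradient -/

/-- Unbiasedness over the mask. The masks are independent and the estimator is a product over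
vertices: a neighbour `j ≠ i` contributes `1` when hidden and `(E j - q) / (1 - q)` when shown, with
mean `E j`; the vertices `v` and `i` contribute `0` when hidden, which `1 / (1 - q)` compensates. -/
lemma sum_mask_gMiss {n : ℕ} {v : Fin n} (q : ℝ) (hq : q < 1) (w : Coord v → ℝ)
    (z : Config n) (i : {j : Fin n // j ≠ v}) :
    ∑ c : Fin n → Bool, (∏ k, if c k then q else 1 - q) * gMiss q v w (corrupt z c) i =
      -(spin z v * spin z i) * Real.exp (-∑ j, toBall w j * spin z v * spin z j) := by
  have hq' : 1 - q ≠ 0 := by linarith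
  set E : {j : Fin n // j ≠ v} → ℝ := fun j => Real.exp (-(toBall w j * spin z v * spin z j))
  set ψ : {j : Fin n // j ≠ v} → Bool → ℝ := fun j b =>
    if j = i then (if b then 0 else E j * spin z j / (1 - q))
    else (if b then 1 else (E j - q) / (1 - q)) with hψ
  set φ : Fin n → Bool → ℝ := fun k b =>
    if h : k = v then (if b then 0 else -(spin z v / (1 - q))) else ψ ⟨k, h⟩ b with hφ
  have hφv : ∀ b, φ v b = if b then 0 else -(spin z v / (1 - q)) := fun b => by simp [hφ]
  have hφj : ∀ (j : {j : Fin n // j ≠ v}) b, φ j b = ψ j b := fun j b => by simp [hφ, j.2]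
  have h1 : ∀ c : Fin n → Bool, gMiss q v w (corrupt z c) i = ∏ k, φ k (c k) := by
    intro c
    rw [Fintype.prod_eq_mul_prod_subtype_ne _ v]
    simp_rw [hφv, hφj]
    unfold gMiss
    rcases hv : c v with _ | _
    · have e1 : (corrupt z c v).toReal = spin z v := by simp [corrupt, hv, Entry.toReal, spin]
      rw [← Finset.mul_prod_erase _ _ (Finset.mem_univ i), e1, mul_assoc]
      simp only [Bool.false_eq_true, if_false]
      congr 2
      · rcases hi : c i with _ | _
        · simp [corrupt, hi, Entry.toReal, spin, hψ, E]
        · simp [corrupt, hi, Entry.toReal, hψ]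
      · refine Finset.prod_congr rfl fun j hj => ?_
        rcases hi : c j with _ | _
        · simp [corrupt, hi, Entry.toReal, spin, hψ, E, Finset.ne_of_mem_erase hj]
        · simp [corrupt, hi, Entry.toReal, hψ, Finset.ne_of_mem_erase hj, hq']
    · simp [corrupt, hv, Entry.toReal]
  simp_rw [h1, ← Finset.prod_mul_distrib]
  rw [sum_prod_bool fun k b => (if b then q else 1 - q) * φ k b, Fintype.prod_eq_mul_prod_subtype_ne _ v]
  simp only [hφv, hφj, if_true, Bool.false_eq_true, if_false]
  have h2 : ∀ j, q * ψ j true + (1 - q) * ψ j false = (if j = i then spin z i else 1) * E j := by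
    intro j
    simp only [hψ, if_true, Bool.false_eq_true, if_false]
    split_ifs with h
    · subst h
      field_simp
      ring
    · field_simp
      ring
  rw [Finset.prod_congr rfl fun j _ => h2 j, Finset.prod_mul_distrib]
  rw [Finset.prod_ite_eq' Finset.univ i, ← Finset.sum_neg_distrib, Real.exp_sum]
  change _ = _ * ∏ j, E j
  simp only [if_true, Finset.mem_univ]
  field_simp
  ring

lemma meanGrad_eq {n : ℕ} {v : Fin n} (A : Matrix (Fin n) (Fin n) ℝ) (q : I) (hq : (q : ℝ) < 1)
    (w : Coord v → ℝ) (i : {j : Fin n // j ≠ v}) :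
    meanGrad A q v w i = ∑ z, spinWeight A 0 z *
      (-(spin z v * spin z i) * Real.exp (-∑ j, toBall w j * spin z v * spin z j)) := by
  rw [meanGrad, missLaw_sum]
  exact Finset.sum_congr rfl fun z _ => by rw [sum_mask_gMiss q hq]

/-- For `x ≥ 0` from `exp (-x) ≤ 1 / (1 + x)`, for `x ≤ 0` from `exp (-x) ≥ 1 - x`. This is the
quantitative convexity of the exponential used for the screening objective. -/
lemma sq_div_le_mul_one_sub_exp {x a : ℝ} (hx : |x| ≤ a) :
    x ^ 2 / (1 + a) ≤ x * (1 - Real.exp (-x)) := by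
  have ha : 0 ≤ a := (abs_nonneg x).trans hx
  rw [div_le_iff₀ (by linarith)]
  rcases le_total 0 x with h | h
  · rw [abs_of_nonneg h] at hx
    have h1 := Real.add_one_le_exp x
    have h2 : Real.exp (-x) * Real.exp x = 1 := by rw [← Real.exp_add]; simp
    have h3 : Real.exp (-x) * (1 + x) ≤ 1 := by
      rw [← h2]
      exact mul_le_mul_of_nonneg_left (by linarith) (Real.exp_pos _).le
    have h4 : 0 ≤ 1 - Real.exp (-x) := by
      have := Real.exp_le_one_iff.mpr (show -x ≤ 0 by linarith)
      linarith
    have h5 : x ≤ (1 - Real.exp (-x)) * (1 + a) := by nlinarith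
    nlinarith
  · have h1 := Real.add_one_le_exp (-x)
    have h2 : x ^ 2 ≤ x * (1 - Real.exp (-x)) := by nlinarith
    have h3 : 0 ≤ x * (1 - Real.exp (-x)) := (sq_nonneg x).trans h2
    nlinarith

section Curvature

variable {n : ℕ} {v : Fin n} {A : Matrix (Fin n) (Fin n) ℝ} {lam : ℝ}

/-- The linear form `∑ d_j z_v z_j` of a spin configuration. -/
def pairForm (v : Fin n) (d : {j : Fin n // j ≠ v} → ℝ) (z : Config n) : ℝ :=
  ∑ j, d j * spin z v * spin z j

lemma abs_pairForm_le (d : {j : Fin n // j ≠ v} → ℝ) (z : Config n) :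
    |pairForm v d z| ≤ ∑ j, |d j| := by
  refine (Finset.abs_sum_le_sum_abs _ _).trans (le_of_eq ?_)
  exact Finset.sum_congr rfl fun j _ => by rw [abs_mul, abs_mul, abs_spin, abs_spin]; ring

lemma pairForm_flip_self (d : {j : Fin n // j ≠ v} → ℝ) (z : Config n) :
    pairForm v d (flip v z) = -pairForm v d z := by
  unfold pairForm
  rw [← Finset.sum_neg_distrib]
  refine Finset.sum_congr rfl fun j _ => ?_
  rw [spin_flip_self, spin_flip_of_ne j.2]
  ring

lemma pairForm_flip (d : {j : Fin n // j ≠ v} → ℝ) (z : Config n) (i : {j : Fin n // j ≠ v}) :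
    pairForm v d (flip i z) = pairForm v d z - 2 * (d i * spin z v * spin z i) := by
  unfold pairForm
  have h : ∀ j, d j * spin (flip (i : Fin n) z) v * spin (flip (i : Fin n) z) j =
      d j * spin z v * spin z j - if j = i then 2 * (d i * spin z v * spin z i) else 0 := by
    intro j
    rw [spin_flip_of_ne i.2.symm, spin_flip]
    by_cases hj : j = i
    · subst hj
      simp
      ring
    · simp [hj, Subtype.coe_inj]
  simp_rw [h, Finset.sum_sub_distrib]
  simp

lemma sum_abs_row_ne_le (hrow : ∀ i, ∑ j, |A i j| ≤ lam) :
    ∑ j : {j : Fin n // j ≠ v}, |A v j| ≤ lam := by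
  have h := Fintype.sum_eq_add_sum_subtype_ne (fun j => |A v j|) v
  linarith [hrow v, abs_nonneg (A v v)]

lemma sum_row_eq_pairForm (h0 : ∀ i, A i i = 0) (z : Config n) :
    ∑ j, A v j * spin z v * spin z j = pairForm v (fun j => A v j) z := by
  rw [Fintype.sum_eq_add_sum_subtype_ne _ v, h0]
  simp [pairForm]

/-- The gradient of the interaction screening objective vanishes at the true weights. -/
lemma sum_pairForm_mul_exp_eq_zero (hA : A.IsSymm) (h0 : ∀ i, A i i = 0)
    (d : {j : Fin n // j ≠ v} → ℝ) :
    ∑ z, spinWeight A 0 z * Real.exp (-pairForm v (fun j => A v j) z) * pairForm v d z = 0 := by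
  set f : Config n → ℝ := fun z =>
    spinWeight A 0 z * Real.exp (-pairForm v (fun j => A v j) z) * pairForm v d z with hf
  -- Multiplying the Ising weight by `exp (-pairForm)` at the true row removes its dependence on the
  -- spin at `v`, while `pairForm v d` is odd in that spin.
  have h1 : ∀ z, f (flip v z) = -f z := fun z => by
    simp only [hf]
    rw [spinWeight_flip hA h0, sum_row_eq_pairForm h0, pairForm_flip_self, pairForm_flip_self,
      mul_assoc (spinWeight A 0 z), ← Real.exp_add]
    have e : -(2 * pairForm v (fun j => A v j) z) + - -pairForm v (fun j => A v j) z =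
        -pairForm v (fun j => A v j) z := by ring
    rw [e]
    ring
  have h2 := Equiv.sum_comp (flip v) f
  simp_rw [h1, Finset.sum_neg_distrib] at h2
  change ∑ z, f z = 0
  linarith

/-- Pair each configuration with its flip at the neighbour `i`: the two values of the form differ by
`2 * d i` in absolute value, so their squares sum to at least `2 * d i ^ 2`, and the flip costs a
factor of at least `exp (-(2 * lam))` in weight. -/
lemma le_sum_pairForm_sq (hA : A.IsSymm) (h0 : ∀ i, A i i = 0)
    (hrow : ∀ i, ∑ j, |A i j| ≤ lam) (d : {j : Fin n // j ≠ v} → ℝ) (i : {j : Fin n // j ≠ v}) :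
    Real.exp (-(2 * lam)) * d i ^ 2 ≤ ∑ z, spinWeight A 0 z * pairForm v d z ^ 2 := by
  set f : Config n → ℝ := fun z => spinWeight A 0 z * pairForm v d z ^ 2 with hf
  have h1 := Equiv.sum_comp (flip (i : Fin n)) f
  have h2 : ∀ z, spinWeight A 0 z * (2 * (Real.exp (-(2 * lam)) * d i ^ 2)) ≤
      f z + f (flip i z) := fun z => by
    have h3 : Real.exp (-(2 * lam)) ≤
        Real.exp (-(2 * ∑ j, A i j * spin z i * spin z j)) := by
      refine Real.exp_le_exp.mpr ?_
      rw [sum_row_eq_pairForm h0]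
      have := (le_abs_self _).trans ((abs_pairForm_le (fun j => A i j) z).trans
        (sum_abs_row_ne_le (v := (i : Fin n)) hrow))
      linarith
    have h4 : Real.exp (-(2 * lam)) ≤ 1 := by
      have : 0 ≤ lam := (Finset.sum_nonneg fun j _ => abs_nonneg _).trans (hrow v)
      exact Real.exp_le_one_iff.mpr (by linarith)
    have hP := spinWeight_pos A 0 z
    simp only [hf, spinWeight_flip hA h0]
    set F := pairForm v d z
    set F' := pairForm v d (flip (i : Fin n) z) with hF'
    have h5 : (F - F') ^ 2 = 4 * d i ^ 2 := by
      rw [hF', pairForm_flip]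
      have h6 := spin_mul_self z v
      have h7 := spin_mul_self z i
      calc _ = 4 * d i ^ 2 * (spin z v * spin z v) * (spin z i * spin z i) := by ring
        _ = _ := by rw [h6, h7]; ring
    have h6 : 2 * d i ^ 2 ≤ F ^ 2 + F' ^ 2 := by nlinarith [sq_nonneg (F + F')]
    have h7 := mul_le_mul_of_nonneg_right h4 (sq_nonneg F)
    have h8 := mul_le_mul_of_nonneg_right h3 (sq_nonneg F')
    have h9 := mul_le_mul_of_nonneg_left h6 (Real.exp_pos (-(2 * lam))).le
    rw [mul_assoc, ← mul_add]
    refine mul_le_mul_of_nonneg_left ?_ hP.le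
    linarith
  have h3 := Finset.sum_le_sum fun z (_ : z ∈ Finset.univ) => h2 z
  rw [← Finset.sum_mul, sum_spinWeight, Finset.sum_add_distrib, h1] at h3
  linarith

/-- Strong convexity of the interaction screening objective along the segment to its minimizer. -/
lemma le_sum_mul_meanGrad (hA : A.IsSymm) (h0 : ∀ i, A i i = 0)
    (hrow : ∀ i, ∑ j, |A i j| ≤ lam) (q : I) (hq : (q : ℝ) < 1) {w : Coord v → ℝ}
    (hw : w ∈ scaledSimplex (Coord v) lam) (i : {j : Fin n // j ≠ v}) :
    Real.exp (-(3 * lam)) / (1 + 2 * lam) * (toBall w i - A v i) ^ 2 ≤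
      ∑ j, (toBall w j - A v j) * meanGrad A q v w j := by
  have hlam : 0 ≤ lam := (Finset.sum_nonneg fun j _ => abs_nonneg _).trans (hrow v)
  set d : {j : Fin n // j ≠ v} → ℝ := fun j => toBall w j - A v j with hd
  set a : {j : Fin n // j ≠ v} → ℝ := fun j => A v j with ha
  have hwa : ∀ z, ∑ j, toBall w j * spin z v * spin z j = pairForm v a z + pairForm v d z := by
    intro z
    unfold pairForm
    rw [← Finset.sum_add_distrib]
    exact Finset.sum_congr rfl fun j _ => by simp only [hd, ha]; ring
  -- The vanishing gradient at the true row is added to create the factor `1 - exp (-pairForm v d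
  -- z)`.
  have h1 : ∑ j, d j * meanGrad A q v w j = ∑ z, spinWeight A 0 z * Real.exp (-pairForm v a z) *
      (pairForm v d z * (1 - Real.exp (-pairForm v d z))) := by
    have h2 := sum_pairForm_mul_exp_eq_zero (v := v) hA h0 d
    have h3 : ∑ j, d j * meanGrad A q v w j = -∑ z, spinWeight A 0 z *
        Real.exp (-pairForm v a z) * (pairForm v d z * Real.exp (-pairForm v d z)) := by
      simp_rw [meanGrad_eq A q hq, Finset.mul_sum]
      rw [Finset.sum_comm, ← Finset.sum_neg_distrib]
      refine Finset.sum_congr rfl fun z _ => ?_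
      rw [hwa, neg_add, Real.exp_add]
      generalize Real.exp (-pairForm v a z) = E₁
      generalize Real.exp (-pairForm v d z) = E₂
      rw [pairForm]
      simp only [Finset.sum_mul, Finset.mul_sum, ← Finset.sum_neg_distrib]
      exact Finset.sum_congr rfl fun j _ => by ring
    rw [h3]
    simp_rw [mul_sub, mul_one, Finset.sum_sub_distrib]
    rw [h2]
    ring
  -- Here `exp (-lam)` bounds the factor at the true row, and `2 * lam` bounds `|pairForm v d z|`,
  -- both rows having `ℓ₁` norm at most `lam`. The further `exp (-(2 * lam))` comes from the flip.
  have h2 : ∀ z, spinWeight A 0 z * pairForm v d z ^ 2 * (Real.exp (-lam) / (1 + 2 * lam)) ≤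
      spinWeight A 0 z * Real.exp (-pairForm v a z) *
      (pairForm v d z * (1 - Real.exp (-pairForm v d z))) := fun z => by
    have h3 : |pairForm v d z| ≤ 2 * lam := by
      refine (abs_pairForm_le d z).trans ?_
      refine (Finset.sum_le_sum fun j _ => abs_sub (toBall w j) (A v j)).trans ?_
      rw [Finset.sum_add_distrib]
      linarith [sum_abs_toBall_le hw, sum_abs_row_ne_le (v := v) hrow]
    have h4 : Real.exp (-lam) ≤ Real.exp (-pairForm v a z) := by
      refine Real.exp_le_exp.mpr (neg_le_neg ?_)
      exact (le_abs_self _).trans ((abs_pairForm_le a z).trans (sum_abs_row_ne_le hrow))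
    have h5 := sq_div_le_mul_one_sub_exp h3
    have h6 := mul_le_mul h4 h5 (by positivity) (Real.exp_pos _).le
    have h7 := mul_le_mul_of_nonneg_left h6 (spinWeight_pos A 0 z).le
    refine (le_of_eq ?_).trans (h7.trans (le_of_eq ?_)) <;> ring
  have h3 := Finset.sum_le_sum fun z (_ : z ∈ Finset.univ) => h2 z
  rw [← Finset.sum_mul, ← h1] at h3
  refine le_trans ?_ h3
  have h4 := mul_le_mul_of_nonneg_right (le_sum_pairForm_sq hA h0 hrow d i)
    (show 0 ≤ Real.exp (-lam) / (1 + 2 * lam) by positivity)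
  refine (le_of_eq ?_).trans h4
  have e : Real.exp (-(3 * lam)) = Real.exp (-(2 * lam)) * Real.exp (-lam) := by
    rw [← Real.exp_add]; congr 1; ring
  rw [e]
  ring

end Curvature

/-! ### Recovery -/

lemma gradBound_pos {lam q : ℝ} (hq : q < 1) : 0 < gradBound lam q :=
  div_pos (Real.exp_pos _) (pow_pos (by linarith) 2)

lemma stepSize_nonneg (n : ℕ) (lam q : ℝ) (T : ℕ) : 0 ≤ stepSize n lam q T := by
  have := gradBound_nonneg lam q
  unfold stepSize
  exact le_min (by positivity) (by positivity)

lemma stepSize_mul_gradBound_le (n : ℕ) (lam q : ℝ) (T : ℕ) :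
    stepSize n lam q T * gradBound lam q ≤ 1 / 8 := by
  rcases (gradBound_nonneg lam q).eq_or_lt with h | h
  · rw [← h]; norm_num
  · refine (mul_le_mul_of_nonneg_right (min_le_left _ _) h.le).trans (le_of_eq ?_)
    field_simp

/-- The assumption `2 * L ≤ T` gives `r ≤ 1`, so the cap `1 / (8 * B)` on the step costs only a
constant: the two terms are at most `8 * B * r * T` and `4 * B * r * T` in either case. -/
lemma stepSize_regret_le {n T : ℕ} {lam q L : ℝ} (hn : 2 ≤ n) (hT : 1 ≤ T) (hq : q < 1)
    (hL : Real.log (2 * (n : ℝ) - 1) ≤ 2 * L) (hLT : 2 * L ≤ T) :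
    0 < stepSize n lam q T ∧
      Real.log (2 * (n : ℝ) - 1) / stepSize n lam q T +
        8 * stepSize n lam q T * T * gradBound lam q ^ 2 ≤
      12 * gradBound lam q * √(2 * T * L) := by
  have hn' : (2 : ℝ) ≤ n := by exact_mod_cast hn
  have hT' : (0 : ℝ) < T := by positivity
  have hB := gradBound_pos (lam := lam) hq
  have hK : 0 < Real.log (2 * (n : ℝ) - 1) := Real.log_pos (by linarith)
  unfold stepSize
  set B := gradBound lam q
  set K := Real.log (2 * (n : ℝ) - 1)
  set r := √(K / T) with hr
  have hr0 : 0 < r := Real.sqrt_pos.mpr (by positivity)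
  have hr1 : r ≤ 1 := Real.sqrt_le_one.mpr ((div_le_one hT').mpr (hL.trans hLT))
  have hrK : r ^ 2 * T = K := by
    rw [hr, Real.sq_sqrt (by positivity)]
    field_simp
  have hrS : r * T ≤ √(2 * T * L) := by
    refine Real.le_sqrt_of_sq_le ?_
    have : (r * T) ^ 2 = T * (r ^ 2 * T) := by ring
    rw [this, hrK]
    nlinarith
  have hη : 0 < min (1 / (8 * B)) (1 / (2 * B) * r) := lt_min (by positivity) (by positivity)
  refine ⟨hη, ?_⟩
  have h1 : K / min (1 / (8 * B)) (1 / (2 * B) * r) ≤ 8 * B * (r * T) := by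
    rw [div_le_iff₀ hη, ← hrK]
    rcases min_choice (1 / (8 * B)) (1 / (2 * B) * r) with h | h <;> rw [h]
    · have : 8 * B * (r * T) * (1 / (8 * B)) = r * T := by field_simp
      rw [this]
      nlinarith [mul_pos hr0 hT']
    · have : 8 * B * (r * T) * (1 / (2 * B) * r) = 4 * (r ^ 2 * T) := by field_simp; ring
      rw [this]
      nlinarith [mul_pos (pow_pos hr0 2) hT']
  have h2 : 8 * min (1 / (8 * B)) (1 / (2 * B) * r) * T * B ^ 2 ≤ 4 * B * (r * T) := by
    calc _ ≤ 8 * (1 / (2 * B) * r) * T * B ^ 2 := by gcongr; exact min_le_right _ _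
      _ = _ := by field_simp; ring
  calc _ ≤ 12 * B * (r * T) := by linarith
    _ ≤ _ := by gcongr

lemma toBall_smgOutput_sub {n T : ℕ} {v : Fin n} (hT : 1 ≤ T) (lam q : ℝ) (x : Fin T → Obs n)
    (i : {j : Fin n // j ≠ v}) (a : ℝ) :
    toBall (smgOutput lam q v x) i - a =
      (∑ t : Fin T, (toBall (smgIter lam q (stepSize n lam q T) v x t) i - a)) / T := by
  have hT' : (T : ℝ) ≠ 0 := by positivity
  simp only [toBall, smgOutput, Finset.sum_range, Finset.sum_sub_distrib, Finset.sum_const,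
    Finset.card_univ, Fintype.card_fin, nsmul_eq_mul]
  field_simp

lemma abs_toBall_smgOutput_sub_le {n T : ℕ} {v : Fin n} {lam q : ℝ} (hT : 1 ≤ T) (hlam : 0 < lam)
    (hq0 : 0 ≤ q) (hq1 : q ≤ 1) (x : Fin T → Obs n) (i : {j : Fin n // j ≠ v}) {a : ℝ}
    (ha : |a| ≤ lam) : |toBall (smgOutput lam q v x) i - a| ≤ 2 * lam := by
  have hT' : (0 : ℝ) < T := by positivity
  rw [toBall_smgOutput_sub hT, abs_div, abs_of_pos hT', div_le_iff₀ hT']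
  have h : ∀ t : Fin T, |toBall (smgIter lam q (stepSize n lam q T) v x t) i - a| ≤ 2 * lam := by
    intro t
    have h1 := sum_abs_toBall_le (smgIter_mem (v := v) hlam hq0 hq1 (stepSize_nonneg n lam q T)
      (stepSize_mul_gradBound_le n lam q T) x t)
    have h2 := (Finset.single_le_sum (fun i _ => abs_nonneg (toBall
      (smgIter lam q (stepSize n lam q T) v x t) i)) (Finset.mem_univ i)).trans h1
    linarith [abs_sub (toBall (smgIter lam q (stepSize n lam q T) v x t) i) a]
  refine (Finset.abs_sum_le_sum_abs _ _).trans ((Finset.sum_le_sum fun t _ => h t).trans ?_)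
  simp [mul_comm]

section Recovery

variable {n T : ℕ} {A : Matrix (Fin n) (Fin n) ℝ} {lam : ℝ}

/-- The error of the output when the sampled gradients are as good as their means. -/
lemma smgOutput_error_sq_le {v : Fin n} (hA : A.IsSymm) (h0 : ∀ i, A i i = 0) (hlam : 0 < lam)
    (hrow : ∀ i, ∑ j, |A i j| ≤ lam) (hn : 2 ≤ n) (hT : 1 ≤ T) (q : I) (hq : (q : ℝ) < 1) {L : ℝ}
    (hL : Real.log (2 * (n : ℝ) - 1) ≤ 2 * L) (hLT : 2 * L ≤ T) (x : Fin T → Obs n)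
    (hx : ∑ t : Fin T, ∑ i, (toBall (smgIter lam q (stepSize n lam q T) v x t) i - A v i) *
          (meanGrad A q v (smgIter lam q (stepSize n lam q T) v x t) i -
            gMiss q v (smgIter lam q (stepSize n lam q T) v x t) (x t) i) ≤
      4 * lam * gradBound lam q * √(2 * T * L)) (i : {j : Fin n // j ≠ v}) :
    Real.exp (-(3 * lam)) / (1 + 2 * lam) * (toBall (smgOutput lam q v x) i - A v i) ^ 2 * T ≤
      16 * lam * gradBound lam q * √(2 * T * L) := by
  have hT' : (0 : ℝ) < T := by positivity
  obtain ⟨hη, hreg⟩ := stepSize_regret_le (lam := lam) hn hT hq hL hLT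
  have hηB := stepSize_mul_gradBound_le n lam q T
  set η := stepSize n lam q T with hηdef
  have h1 := smg_regret hlam q.2.1 hq.le hη hηB x (fun j => A v j)
    (sum_abs_row_ne_le (v := v) hrow)
  have h2 := Finset.sum_le_sum fun t (_ : t ∈ (Finset.univ : Finset (Fin T))) =>
    le_sum_mul_meanGrad hA h0 hrow q hq (smgIter_mem (v := v) hlam q.2.1 hq.le hη.le hηB x t) i
  rw [← Finset.mul_sum] at h2
  -- Convexity of the square passes from the iterates to their average. In the final constant, `16`
  -- is `12` from the regret plus `4` from the martingale.
  have h3 : (toBall (smgOutput lam q v x) i - A v i) ^ 2 * T ≤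
      ∑ t : Fin T, (toBall (smgIter lam q η v x t) i - A v i) ^ 2 := by
    rw [toBall_smgOutput_sub hT]
    have := sq_sum_le_card_mul_sum_sq (s := (Finset.univ : Finset (Fin T)))
      (f := fun t => toBall (smgIter lam q η v x t) i - A v i)
    rw [Finset.card_univ, Fintype.card_fin] at this
    rw [div_pow, div_mul_eq_mul_div, div_le_iff₀ (by positivity)]
    nlinarith
  simp_rw [mul_sub, Finset.sum_sub_distrib] at hx
  have h4 := mul_le_mul_of_nonneg_left hreg hlam.le
  have h5 := mul_le_mul_of_nonneg_left h3
    (show 0 ≤ Real.exp (-(3 * lam)) / (1 + 2 * lam) by positivity)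
  rw [mul_assoc]
  linarith

/-- Recovery with the true missing probability. -/
lemma samplesLaw_error_sq_le (hA : A.IsSymm) (h0 : ∀ i, A i i = 0) (hlam : 0 < lam)
    (hrow : ∀ i, ∑ j, |A i j| ≤ lam) (hn : 2 ≤ n) (hT : 1 ≤ T) (q : I) (hq : (q : ℝ) < 1) {δ : ℝ}
    (hδ0 : 0 < δ) (hδ1 : δ < 1) (hLT : 2 * Real.log ((n : ℝ) / δ) ≤ T) :
    1 - δ ≤ (samplesLaw A 0 q T).real {x | ∀ (v : Fin n) (i : {j : Fin n // j ≠ v}),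
      Real.exp (-(3 * lam)) / (1 + 2 * lam) * (toBall (smgOutput lam q v x) i - A v i) ^ 2 * T ≤
      16 * lam * gradBound lam q * √(2 * T * Real.log ((n : ℝ) / δ))} := by
  have hn' : (2 : ℝ) ≤ n := by exact_mod_cast hn
  set L := Real.log ((n : ℝ) / δ) with hLdef
  set μ := samplesLaw A 0 q T
  have hnδ : (n : ℝ) ≤ n / δ := by
    rw [le_div_iff₀ hδ0]
    nlinarith
  have hL0 : 0 ≤ L := Real.log_nonneg (by linarith)
  -- Because `2 * n - 1 ≤ n ^ 2 ≤ (n / δ) ^ 2`.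
  have hL : Real.log (2 * (n : ℝ) - 1) ≤ 2 * L := by
    calc Real.log (2 * (n : ℝ) - 1) ≤ Real.log ((n / δ : ℝ) ^ 2) := by
          refine Real.log_le_log (by linarith) ?_
          nlinarith [sq_nonneg ((n : ℝ) - 1)]
      _ = 2 * L := by rw [Real.log_pow, hLdef, Nat.cast_two]
  set bad : Fin n → Set (Fin T → Obs n) := fun v => {x | 4 * lam * gradBound lam q * √(2 * T * L) ≤
        ∑ t : Fin T, ∑ i, (toBall (smgIter lam q (stepSize n lam q T) v x t) i - A v i) *
          (meanGrad A q v (smgIter lam q (stepSize n lam q T) v x t) i -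
            gMiss q v (smgIter lam q (stepSize n lam q T) v x t) (x t) i)} with hbad
  -- One event per vertex covers all its neighbours, since the curvature bound holds for each
  -- coordinate; the union bound is over `n` events only.
  have h1 : ∀ v, μ.real (bad v) ≤ δ / n := fun v => by
    refine (measureReal_martingale_ge_le hlam hT A q hq (stepSize_nonneg n lam q T)
      (stepSize_mul_gradBound_le n lam q T) (fun j => A v j) (sum_abs_row_ne_le hrow) hL0).trans
      (le_of_eq ?_)
    rw [Real.exp_neg, hLdef, Real.exp_log (by positivity), inv_div]
  have h2 : μ.real (⋃ v, bad v) ≤ δ := by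
    refine (measureReal_iUnion_fintype_le _).trans ((Finset.sum_le_sum fun v _ => h1 v).trans
      (le_of_eq ?_))
    simp only [Finset.sum_const, Finset.card_univ, Fintype.card_fin, nsmul_eq_mul]
    field_simp
  have h3 : 1 - δ ≤ μ.real (⋃ v, bad v)ᶜ := by
    rw [probReal_compl_eq_one_sub .of_discrete]
    linarith
  refine h3.trans (measureReal_mono fun x hx v i => ?_)
  simp only [Set.mem_compl_iff, Set.mem_iUnion, not_exists] at hx
  exact smgOutput_error_sq_le hA h0 hlam hrow hn hT q hq hL hLT x (not_le.mp (hx v)).le i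

end Recovery

/-! ### Two-stage sampling and the constants of the sample complexity. -/

lemma one_sub_le_prod_real {α β : Type*} [Fintype α] [Fintype β] [MeasurableSpace α]
    [MeasurableSpace β] [MeasurableSingletonClass α] [MeasurableSingletonClass β]
    (μ : Measure α) (ν : Measure β) [IsProbabilityMeasure μ] [IsProbabilityMeasure ν]
    {E : Set α} {G : Set (α × β)} {a b : ℝ} (hb : 0 ≤ b) (hE : 1 - a ≤ μ.real E)
    (hG : ∀ x ∈ E, 1 - b ≤ ν.real {y | (x, y) ∈ G}) :
    1 - (a + b) ≤ (μ.prod ν).real G := by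
  classical
  have h1 : (μ.prod ν).real G = ∑ x, μ.real {x} * ν.real {y | (x, y) ∈ G} := by
    rw [measureReal_eq_sum, Fintype.sum_prod_type]
    refine Finset.sum_congr rfl fun x _ => ?_
    rw [measureReal_eq_sum ν, Finset.mul_sum]
    refine Finset.sum_congr rfl fun y _ => ?_
    rw [← Set.singleton_prod_singleton, measureReal_prod_prod, mul_ite, mul_zero]
    rfl
  have h2 : μ.real E * (1 - b) ≤ (μ.prod ν).real G := by
    rw [h1, measureReal_eq_sum μ, Finset.sum_mul]
    refine Finset.sum_le_sum fun x _ => ?_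
    split_ifs with hx
    · exact mul_le_mul_of_nonneg_left (hG x hx) measureReal_nonneg
    · rw [zero_mul]
      positivity
  have h3 : μ.real E ≤ 1 := measureReal_le_one
  nlinarith

/-- The constant in the exponent of the sample complexity. -/
def sampleConst (p : ℝ) : ℝ := 6 + 4 / (1 - p) + Real.log (73728 / (1 - p) ^ 4)

/-- The number `73728 = 512 * 9 * 16` collects the constants of `abs_error_le`: `2 * 16 ^ 2` from
the error bound, `9` from `1 + 2 * lam ≤ 3 * max 1 lam`, and `16` from the square of `gradBound_le`.
-/
lemma one_le_ratio {p : ℝ} (hp0 : 0 < p) (hp1 : p < 1) : 73728 ≤ 73728 / (1 - p) ^ 4 := by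
  rw [le_div_iff₀ (pow_pos (by linarith) 4)]
  have := pow_le_one₀ (n := 4) (show 0 ≤ 1 - p by linarith) (by linarith)
  linarith

lemma sampleConst_pos {p : ℝ} (hp0 : 0 < p) (hp1 : p < 1) : 0 < sampleConst p := by
  have h1 := Real.log_nonneg (by linarith [one_le_ratio hp0 hp1] : 1 ≤ 73728 / (1 - p) ^ 4)
  have h2 : 0 < 1 - p := by linarith
  unfold sampleConst
  positivity

/-- As `max 1 lam ≥ 1`, the prefactor can be moved into the exponent. -/
lemma ratio_mul_exp_le {p lam : ℝ} (hp0 : 0 < p) (hp1 : p < 1) :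
    73728 / (1 - p) ^ 4 * Real.exp ((6 + 4 / (1 - p)) * lam) ≤
      Real.exp (sampleConst p * max 1 lam) := by
  have h1 := one_le_ratio hp0 hp1
  have h2 := Real.log_nonneg (by linarith : 1 ≤ 73728 / (1 - p) ^ 4)
  have h3 : 0 < 1 - p := by linarith
  have h4 : 0 ≤ 6 + 4 / (1 - p) := by positivity
  calc _ = Real.exp (Real.log (73728 / (1 - p) ^ 4) + (6 + 4 / (1 - p)) * lam) := by
        rw [Real.exp_add, Real.exp_log (by linarith)]
    _ ≤ _ := by
        refine Real.exp_le_exp.mpr ?_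
        unfold sampleConst
        nlinarith [le_max_left 1 lam, mul_le_mul_of_nonneg_left (le_max_right 1 lam) h4,
          mul_le_mul_of_nonneg_left (le_max_left 1 lam) h2]

/-- When `ε ≤ 2 * lam`, one has `ε ^ 4 ≤ 16 * lam ^ 2 * (max 1 lam) ^ 2`, so the sample size has a
lower bound free of `ε` and `lam`; here `4608 = 73728 / 16`. -/
lemma ratio_mul_log_le {p lam ε L T : ℝ} (hp0 : 0 < p) (hp1 : p < 1) (hlam : 0 < lam)
    (hε : 0 < ε) (hle : ε ≤ 2 * lam) (hL : 0 ≤ L)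
    (hT : lam ^ 2 * (max 1 lam) ^ 2 * L * Real.exp (sampleConst p * max 1 lam) / ε ^ 4 ≤ T) :
    4608 / (1 - p) ^ 4 * L ≤ T := by
  refine le_trans ?_ hT
  rw [le_div_iff₀ (by positivity)]
  have h3 : 0 < 1 - p := by linarith
  have h1 : 73728 / (1 - p) ^ 4 ≤ Real.exp (sampleConst p * max 1 lam) := by
    refine le_trans ?_ (ratio_mul_exp_le (lam := lam) hp0 hp1)
    refine le_mul_of_one_le_right (by positivity) (Real.one_le_exp (by positivity))
  have h2 : ε ^ 4 ≤ 16 * (lam ^ 2 * (max 1 lam) ^ 2) := by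
    calc ε ^ 4 ≤ (2 * lam) ^ 4 := by gcongr
      _ = 16 * (lam ^ 2 * lam ^ 2) := by ring
      _ ≤ _ := by gcongr; exact le_max_right _ _
  calc 4608 / (1 - p) ^ 4 * L * ε ^ 4 ≤
        4608 / (1 - p) ^ 4 * L * (16 * (lam ^ 2 * (max 1 lam) ^ 2)) := by gcongr
    _ = lam ^ 2 * (max 1 lam) ^ 2 * L * (73728 / (1 - p) ^ 4) := by ring
    _ ≤ _ := by gcongr

lemma gradBound_le {p q lam : ℝ} (hp1 : p < 1) (hlam : 0 < lam) (hq : (1 - p) / 2 ≤ 1 - q) :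
    gradBound lam q ≤ 4 / (1 - p) ^ 2 * Real.exp (2 * lam / (1 - p)) := by
  have h3 : 0 < 1 - p := by linarith
  calc gradBound lam q ≤ Real.exp (lam / ((1 - p) / 2)) / ((1 - p) / 2) ^ 2 := by
        unfold gradBound; gcongr
    _ = _ := by
        have : lam / ((1 - p) / 2) = 2 * lam / (1 - p) := by field_simp
        rw [this]
        field_simp
        ring

lemma abs_error_le {p q lam ε L T e : ℝ} (hp0 : 0 < p) (hp1 : p < 1) (hlam : 0 < lam)
    (hε : 0 < ε) (hL : 0 ≤ L) (hq : (1 - p) / 2 ≤ 1 - q) (hT0 : 0 < T)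
    (hT : lam ^ 2 * (max 1 lam) ^ 2 * L * Real.exp (sampleConst p * max 1 lam) / ε ^ 4 ≤ T)
    (he : Real.exp (-(3 * lam)) / (1 + 2 * lam) * e ^ 2 * T ≤
      16 * lam * gradBound lam q * √(2 * T * L)) : |e| ≤ ε := by
  have h3 : 0 < 1 - p := by linarith
  have hB := gradBound_le hp1 hlam hq
  have hB0 := gradBound_nonneg lam q
  set B := gradBound lam q
  set M : ℝ := Real.exp (3 * lam) * (1 + 2 * lam) * (16 * lam * B) with hM
  have h1 : e ^ 2 * T ≤ M * √(2 * T * L) := by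
    have h2 := mul_le_mul_of_nonneg_left he
      (show 0 ≤ Real.exp (3 * lam) * (1 + 2 * lam) by positivity)
    have h4 : Real.exp (3 * lam) * (1 + 2 * lam) *
        (Real.exp (-(3 * lam)) / (1 + 2 * lam) * e ^ 2 * T) = e ^ 2 * T := by
      rw [Real.exp_neg]
      field_simp
    rw [h4] at h2
    refine h2.trans (le_of_eq ?_)
    rw [hM]; ring
  -- This is `M * √(2 * T * L) ≤ T * ε ^ 2` squared and divided by `T`.
  have h5 : 2 * M ^ 2 * L ≤ T * ε ^ 4 := by
    rw [div_le_iff₀ (by positivity)] at hT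
    refine le_trans ?_ hT
    have h6 : (1 + 2 * lam) ^ 2 ≤ 9 * (max 1 lam) ^ 2 := by
      have h7 : 1 + 2 * lam ≤ 3 * max 1 lam := by
        linarith [le_max_left 1 lam, le_max_right 1 lam]
      calc (1 + 2 * lam) ^ 2 ≤ (3 * max 1 lam) ^ 2 := by gcongr
        _ = _ := by ring
    have h8 : B ^ 2 ≤ 16 / (1 - p) ^ 4 * Real.exp (4 / (1 - p) * lam) := by
      calc B ^ 2 ≤ (4 / (1 - p) ^ 2 * Real.exp (2 * lam / (1 - p))) ^ 2 := by gcongr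
        _ = _ := by
          rw [mul_pow, ← Real.exp_nat_mul, div_pow, ← pow_mul]
          norm_num
          left
          ring
    have h9 : Real.exp (3 * lam) ^ 2 = Real.exp (6 * lam) := by
      rw [← Real.exp_nat_mul]; congr 1; push_cast; ring
    calc 2 * M ^ 2 * L = 512 * lam ^ 2 * Real.exp (6 * lam) * (1 + 2 * lam) ^ 2 * B ^ 2 * L := by
          rw [hM, ← h9]; ring
      _ ≤ 512 * lam ^ 2 * Real.exp (6 * lam) * (9 * (max 1 lam) ^ 2) *
          (16 / (1 - p) ^ 4 * Real.exp (4 / (1 - p) * lam)) * L := by gcongr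
      _ = lam ^ 2 * (max 1 lam) ^ 2 * L *
          (73728 / (1 - p) ^ 4 * Real.exp ((6 + 4 / (1 - p)) * lam)) := by
          rw [add_mul 6, Real.exp_add]; ring
      _ ≤ _ := by
          gcongr
          exact ratio_mul_exp_le hp0 hp1
  have h6 : M * √(2 * T * L) ≤ T * ε ^ 2 := by
    refine (le_abs_self _).trans (abs_le_of_sq_le_sq ?_ (by positivity))
    rw [mul_pow, Real.sq_sqrt (by positivity)]
    nlinarith
  have h7 : e ^ 2 ≤ ε ^ 2 := by
    have := h1.trans h6
    rw [mul_comm] at this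
    exact le_of_mul_le_mul_left this hT0
  exact abs_le_of_sq_le_sq h7 hε.le

lemma pHat_mem {n m : ℕ} (x : Fin m → Obs n) : pHat x ∈ I := by
  rw [pHat_eq]
  refine ⟨by positivity, div_le_one_of_le₀ ?_ (by positivity)⟩
  have := missCount_le x
  rw [mul_comm] at this
  exact_mod_cast this

/-- Recovery with the estimated missing probability. -/
lemma recovery_pHat {n T m : ℕ} (hn : 1 ≤ n) (hT : 1 ≤ T) {A : Matrix (Fin n) (Fin n) ℝ}
    (hA : A.IsSymm) (h0 : ∀ i, A i i = 0) (p : I) (hp0 : 0 < (p : ℝ)) (hp1 : (p : ℝ) < 1)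
    {δ lam ε : ℝ} (hδ0 : 0 < δ) (hδ1 : δ < 1) (hlam : 0 < lam) (hrow : ∀ i, ∑ j, |A i j| ≤ lam)
    (hε : 0 < ε)
    (hTlam : lam ^ 2 * (max 1 lam) ^ 2 * Real.log ((n : ℝ) / δ) *
      Real.exp (sampleConst p * max 1 lam) / ε ^ 4 ≤ (T : ℝ))
    (hm : 2 * ((T : ℝ) / δ ^ 2) * Real.log (2 / δ) ≤ (m : ℝ)) :
    1 - (tvConst p + 2) * δ ≤ ((samplesLaw A 0 p m).prod (samplesLaw A 0 p T)).real
      {xy | ∀ (v : Fin n) (i : {j : Fin n // j ≠ v}),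
        |toBall (smgOutput lam (pHat xy.1) v xy.2) i - A v i| ≤ ε} := by
  have hK : 0 ≤ tvConst p := Real.sqrt_nonneg _
  have hT' : (0 : ℝ) < T := by positivity
  -- Two cases hold for every outcome: `ε > 2 * lam`, where the diameter of the `ℓ₁` ball suffices,
  -- and `n = 1`, where there is no neighbour.
  have huniv : (∀ (x : Fin m → Obs n) (y : Fin T → Obs n) (v : Fin n) (i : {j : Fin n // j ≠ v}),
      |toBall (smgOutput lam (pHat x) v y) i - A v i| ≤ ε) →
      1 - (tvConst p + 2) * δ ≤ ((samplesLaw A 0 p m).prod (samplesLaw A 0 p T)).real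
      {xy | ∀ (v : Fin n) (i : {j : Fin n // j ≠ v}),
        |toBall (smgOutput lam (pHat xy.1) v xy.2) i - A v i| ≤ ε} := fun h => by
    rw [Set.eq_univ_of_forall (s := {xy : (Fin m → Obs n) × (Fin T → Obs n) |
      ∀ (v : Fin n) (i : {j : Fin n // j ≠ v}),
        |toBall (smgOutput lam (pHat xy.1) v xy.2) i - A v i| ≤ ε}) fun xy => h xy.1 xy.2,
      probReal_univ]
    have : 0 ≤ (tvConst p + 2) * δ := by positivity
    linarith
  rcases lt_or_ge (2 * lam) ε with hle | hle
  · refine huniv fun x y v i => (abs_toBall_smgOutput_sub_le hT hlam (pHat_mem x).1 (pHat_mem x).2 y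
      i ?_).trans hle.le
    exact (Finset.single_le_sum (fun j _ => abs_nonneg (A v j)) (Finset.mem_univ (i : Fin n))).trans
      (hrow v)
  rcases hn.eq_or_lt with rfl | hn2
  · exact huniv fun x y v i => absurd (Subsingleton.elim _ _) i.2
  have hn' : (2 : ℝ) ≤ n := by exact_mod_cast hn2
  set L := Real.log ((n : ℝ) / δ)
  have hL : 1 / 2 ≤ L := by
    have h1 : Real.log 2 ≤ L := by
      refine Real.log_le_log two_pos ?_
      rw [le_div_iff₀ hδ0]
      nlinarith
    linarith [Real.log_two_gt_d9]
  have h3 : 0 < 1 - (p : ℝ) := by linarith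
  have hTL := ratio_mul_log_le hp0 hp1 hlam hε hle (by linarith) hTlam
  have hT1 : 2 * L ≤ T := by
    refine le_trans ?_ hTL
    have := one_le_ratio hp0 hp1
    have h4 : (2 : ℝ) ≤ 4608 / (1 - p : ℝ) ^ 4 := by
      have : 4608 / (1 - p : ℝ) ^ 4 = 73728 / (1 - p : ℝ) ^ 4 / 16 := by ring
      linarith
    gcongr
  -- This keeps the estimate away from `1`, so `gradBound` at the estimate is controlled in terms of
  -- `p`.
  have hT2 : δ / √((T : ℝ) * n) ≤ (1 - p) / 2 := by
    have h4 : 4 / (1 - p : ℝ) ^ 2 ≤ T * n := by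
      calc 4 / (1 - p : ℝ) ^ 2 ≤ 4 / (1 - p : ℝ) ^ 4 := by
            refine div_le_div_of_nonneg_left (by norm_num) (by positivity) ?_
            exact pow_le_pow_of_le_one h3.le (by linarith) (by norm_num)
        _ = 8 / (1 - p : ℝ) ^ 4 * (1 / 2) := by ring
        _ ≤ 4608 / (1 - p : ℝ) ^ 4 * L := by gcongr; norm_num
        _ ≤ T := hTL
        _ ≤ T * n := le_mul_of_one_le_right hT'.le (by linarith)
    have h5 : 2 / (1 - p : ℝ) ≤ √((T : ℝ) * n) := by
      refine Real.le_sqrt_of_sq_le (le_trans (le_of_eq ?_) h4)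
      rw [div_pow]; norm_num
    calc δ / √((T : ℝ) * n) ≤ 1 / (2 / (1 - p : ℝ)) := by gcongr
      _ = (1 - p) / 2 := by rw [one_div_div]
  -- The failure budget: `δ` for the estimate, `δ` for the recovery, `tvConst p * δ` for the change
  -- of law.
  have e : (tvConst p + 2) * δ = δ + (δ + tvConst p * δ) := by ring
  rw [e]
  refine one_sub_le_prod_real _ _ (by positivity)
    (pHat_accurate hn hT A 0 p hδ0 hδ1 hm) fun x hx => ?_
  -- With the first block fixed, `q` is a constant independent of the second block. Recovery is
  -- shown under the law with parameter `q`, then carried to the true law as a statement about the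
  -- single event `S`.
  set q : I := ⟨pHat x, pHat_mem x⟩ with hq
  have hqp : |(q : ℝ) - p| ≤ δ / √((T : ℝ) * n) := hx
  have hq1 : (1 - p : ℝ) / 2 ≤ 1 - q := by linarith [(abs_le.mp (hqp.trans hT2)).2]
  have h4 := samplesLaw_error_sq_le hA h0 hlam hrow hn2 hT q (by linarith) hδ0 hδ1 hT1
  set S : Set (Fin T → Obs n) := {y | ∀ (v : Fin n) (i : {j : Fin n // j ≠ v}),
        |toBall (smgOutput lam q v y) i - A v i| ≤ ε}
  have h5 : 1 - δ ≤ (samplesLaw A 0 q T).real S :=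
    h4.trans (measureReal_mono fun y hy v i =>
      abs_error_le hp0 hp1 hlam hε (by linarith) hq1 hT' hTlam (hy v i))
  have h6 := (abs_le.mp (abs_samplesLaw_sub_le_const hn hT A 0 p q hp0 hp1 hδ0 hδ1 hqp S)).1
  change _ ≤ (samplesLaw A 0 p T).real S
  linarith

end IsingMissing

end

theorem mainTheorem7 :
    ∃ C₀ : ℝ, 0 < C₀ ∧ ∀ p : I, 0 < (p : ℝ) → (p : ℝ) < 1 →
      ∃ C K : ℝ, 0 < C ∧ 0 < K ∧
        ∀ (n T : ℕ), 1 ≤ n → 1 ≤ T →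
        ∀ A : Matrix (Fin n) (Fin n) ℝ, A.IsSymm → (∀ i, A i i = 0) →
        ∀ δ : ℝ, 0 < δ → δ < 1 →
          -- accuracy of the empirical estimate from `m` samples
          (∀ (θ : Fin n → ℝ) (m : ℕ),
            C₀ * ((T : ℝ) / δ ^ 2) * Real.log (2 / δ) ≤ (m : ℝ) →
              1 - δ ≤ (IsingMissing.samplesLaw A θ p m).real
                {x | |IsingMissing.pHat x - (p : ℝ)| ≤ δ / Real.sqrt ((T : ℝ) * (n : ℝ))}) ∧
          -- reduction of the total variation distance to binomial laws
          (∀ (θ : Fin n → ℝ) (q : I),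
            IsingMissing.tvDist (IsingMissing.samplesLaw A θ p T)
                (IsingMissing.samplesLaw A θ q T) =
              IsingMissing.tvDist (binomial (n * T) p) (binomial (n * T) q)) ∧
          -- closeness of the joint laws of `T` samples
          (∀ (θ : Fin n → ℝ) (q : I),
            |(q : ℝ) - (p : ℝ)| ≤ δ / Real.sqrt ((T : ℝ) * (n : ℝ)) →
              IsingMissing.tvDist (IsingMissing.samplesLaw A θ p T)
                (IsingMissing.samplesLaw A θ q T) ≤ K * δ) ∧
          -- recovery with the estimate from `m` fresh samples in place of `p`
          (∀ (lam ε : ℝ) (m : ℕ), 0 < lam → (∀ i, ∑ j, |A i j| ≤ lam) → 0 < ε →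
            lam ^ 2 * (max 1 lam) ^ 2 * Real.log ((n : ℝ) / δ) * Real.exp (C * max 1 lam) / ε ^ 4
              ≤ (T : ℝ) →
            C₀ * ((T : ℝ) / δ ^ 2) * Real.log (2 / δ) ≤ (m : ℝ) →
              1 - K * δ ≤ ((IsingMissing.samplesLaw A 0 p m).prod
                  (IsingMissing.samplesLaw A 0 p T)).real
                {xy | ∀ (v : Fin n) (i : {j : Fin n // j ≠ v}),
                  |IsingMissing.toBall (IsingMissing.smgOutput lam (IsingMissing.pHat xy.1) v xy.2) i
                    - A v i| ≤ ε}) := by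
  refine ⟨2, two_pos, fun p hp0 hp1 => ⟨IsingMissing.sampleConst p, IsingMissing.tvConst p + 2,
    IsingMissing.sampleConst_pos hp0 hp1, ?_, ?_⟩⟩
  · have : 0 ≤ IsingMissing.tvConst p := Real.sqrt_nonneg _
    positivity
  intro n T hn hT A hA h0 δ hδ0 hδ1
  refine ⟨fun θ m hm => IsingMissing.pHat_accurate hn hT A θ p hδ0 hδ1 hm,
    fun θ q => IsingMissing.tvDist_samplesLaw A θ p q, fun θ q hq => ?_,
    fun lam ε m hlam hrow hε hTlam hm =>
      IsingMissing.recovery_pHat hn hT hA h0 p hp0 hp1 hδ0 hδ1 hlam hrow hε hTlam hm⟩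
  refine (IsingMissing.tvDist_le fun S _ =>
    IsingMissing.abs_samplesLaw_sub_le_const hn hT A θ p q hp0 hp1 hδ0 hδ1 hq S).trans ?_
  nlinarith
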